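/- **Model.** Let $G$ be a finite connected simple graph on $n$ nodes; at each node $v$ the incident edges are numbered bijectively by ports $0,\dots,\delta(v)-1$, the two port numbers of an edge being unrelated. Let $2\le k\le n$ anonymous robots start at one node $v_R$. Time is divided into synchronous rounds $1,2,\dots$. A round is a sequence of synchronous subrounds followed by a move. In each subround every robot reads messages broadcast by the other robots at its node in the previous subround (an arbitrary part of them, but at least two if at least two were broadcast), gets one fair random bit, independent of all others, computes, and may broadcast a message. When all robots at all nodes have finished computing and no message is pending, each robot stays or moves through a port of its node, and the next round begins. A robot knows only its own memory, the degree $\delta$ of its node and the messages it receives. **Algorithm.** Each robot has variables *role* (initially *explore*), *direction* (initially *forward*), *visited* (initially $0$), and port variables *entered*, *parent*, *child* (initially $\emptyset$); *entered* is set automatically, at each move, to the port through which the robot enters the new node. Write $q=(\textit{entered}+1)\bmod\delta$, with $q=0$ if $\textit{entered}=\emptyset$. A settled robot answers each query with its $(\textit{parent},\textit{child},\textit{visited})=(x,y,b)$, and obeys the instructions "set child", "set visited" and "terminate". A robot with role explore, return or acknowledge begins each round with a query. Then: * *explore*, no answer: the robots at the node elect a leader. First each broadcasts "start"; one that receives nothing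 is alone. Otherwise all are candidates, and in each subround each candidate flips its coin and broadcasts on heads; a candidate with tails that receives a message is no longer a candidate; when exactly one robot broadcasts, it is the leader and all know that the election is over. A robot that is alone gets role return and moves through *entered*. The leader gets role settled, sets *parent* to *entered*, and stays. Any other robot sets *direction* to backward if $q=\textit{entered}$, and moves through $q$. * *explore*, answer $(x,\emptyset,0)$: if *direction* is forward, set it to backward and move through *entered*; if it is backward, set it to forward unless $q=x$, and move through $q$. * *return*, answer $(x,\emptyset,0)$: instruct the settled robot to set *child* to *entered*. If $x\ne\emptyset$, move through $x$; if $x=\emptyset$, get role acknowledge, direction forward, $\textit{entered}=\emptyset$, and stay. * *acknowledge*, answer $(x,y,0)$: instruct the settled robot to set *visited* to $1$; if $q=\textit{entered}$, set *direction* to backward and instruct it to terminate; otherwise, if $q=y$, instruct it to terminate; in all cases move through $q$. * *acknowledge*, answer $(x,y,1)$: if *direction* is forward, set it to backward and move through *entered*. If it is backward: if $q=x$, instruct the settled robot to terminate; otherwise set *direction* to forward and, if $q=y$, instruct it to terminate; in all cases move through $q$. * *acknowledge*, no answer: if *direction* is forward, set it to backward, otherwise get role done; in both cases move through *entered*. *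 *done*: terminate. In all cases not listed, the robot stays, with its variables unchanged. A terminated robot neither moves, nor computes, nor broadcasts. **Theorem.** There are rounds $t_1,t_2$, depending only on $G$, its port numbers, $v_R$ and $k$, such that almost surely (with respect to the coin flips), however the received parts of the messages are chosen, there is a robot $r_L$ such that 1. $t_1$ is the first round at the beginning of which each node has at most one robot, $r_L$ has role explore, and the other $k-1$ robots have role settled; 2. $t_2$ is the first round at the beginning of which $r_L$ is at $v_R$ with role return; 3. round $t_2+t_1+2$ is completed (in particular, all elections up to then end after finitely many subrounds), and from its end on each node has at most one robot and all robots have terminated. So the algorithm solves Dispersion. -/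

import Mathlib

namespace Dispersion

/-! ### Robots: variables, messages and control state -/

/-- The values of the variable *role*. -/
inductive Role
  | explore
  | settled
  | ret
  | acknowledge
  | done
  deriving DecidableEq

/-- The values of the variable *direction*. -/
inductive Direction
  | forward
  | backward
  deriving DecidableEq

/-- The messages that a robot can broadcast. `info x y b` is the answer of a settled robot to a
query: its role is settled, its parent is `x`, its child is `y`, and `b` says whether its variable
*visited* is 1. `start` and `heads` are used in the leader election. -/
inductive Msg
  | query
  | info (parent child : Option ℕ) (visited : Bool)
  | setChild (x : Option ℕ)
  | setVisited
  | terminate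
  | start
  | heads
  deriving DecidableEq

/-- Where a robot stands in its program during a round. -/
inductive Control
  /-- beginning of a round -/
  | begin
  /-- it has broadcast a query, which is being delivered -/
  | asked
  /-- the answer to its query is being delivered -/
  | answer
  /-- it has broadcast `start`, the first message of the leader election -/
  | started
  /-- it takes part in the leader election; `candidate` says whether it is still a candidate and
  `sent` whether it broadcast `heads` in the previous subround -/
  | electing (candidate sent : Bool)
  /-- it still has to broadcast `terminate`; then it is `ready p` -/
  | dismissing (p : Option ℕ)
  /-- its own computation in this round is over, and it will leave via port `p` at the end of the
  round (`none`: it stays) -/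
  | ready (p : Option ℕ)
  /-- it has terminated -/
  | terminated
  deriving DecidableEq

/-- The memory of a robot. A port variable with value `none` is an empty one. -/
structure Robot where
  role : Role
  entered : Option ℕ
  direction : Direction
  parent : Option ℕ
  child : Option ℕ
  visited : Bool
  control : Control
  deriving DecidableEq

/-- The memory of every robot at the beginning of round 1. -/
def Robot.initial : Robot where
  role := .explore
  entered := none
  direction := .forward
  parent := none
  child := none
  visited := false
  control := .begin

/-! ### The program of a robot

Each function below computes the new memory of a robot and the message it broadcasts, if any, from
its present memory, the degree `δ` of the node and the messages it has received. No function has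
access to the identity of the robot or of the node. -/

/-- The port `(entered + 1) mod δ`; for a robot that has not entered through any port, this
is port 0. -/
def nextPort (δ : ℕ) : Option ℕ → ℕ
  | none => 0
  | some p => (p + 1) % δ

/-- The answer of a settled robot among the received messages, if there is one. -/
def answerIn (inbox : List Msg) : Option (Option ℕ × Option ℕ × Bool) :=
  inbox.findSome? fun m => match m with
    | .info x y b => some (x, y, b)
    | _ => none

/-- The value carried by a message "Set child" among the received messages, if there is one. -/
def childIn (inbox : List Msg) : Option (Option ℕ) :=
  inbox.findSome? fun m => match m with
    | .setChild x => some x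
    | _ => none

/-- A settled robot listens in every subround and obeys. -/
def settledStep (r : Robot) (inbox : List Msg) : Robot × Option Msg :=
  if Msg.query ∈ inbox then (r, some (.info r.parent r.child r.visited))
  else match childIn inbox with
    | some x => ({ r with child := x }, none)
    | none =>
      if Msg.setVisited ∈ inbox then ({ r with visited := true }, none)
      else if Msg.terminate ∈ inbox then ({ r with control := .terminated }, none)
      else (r, none)

/-- An exploring robot that is alone at an empty node. -/
def foundAlone (r : Robot) : Robot :=
  { r with role := .ret, control := .ready r.entered }

/-- An exploring robot that has been elected as the leader at an empty node. -/
def foundElected (r : Robot) : Robot :=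
  { r with role := .settled, parent := r.entered, control := .ready none }

/-- An exploring robot that has not been elected as the leader at an empty node. -/
def foundNotElected (δ : ℕ) (r : Robot) : Robot :=
  let q := nextPort δ r.entered
  { r with
    direction := if r.entered = some q then .backward else r.direction
    control := .ready (some q) }

/-- A candidate flips its coin and broadcasts `heads` if it gets heads; others stay silent. -/
def flip (candidate coin : Bool) (r : Robot) : Robot × Option Msg :=
  ({ r with control := .electing candidate (candidate && coin) },
    if candidate && coin then some .heads else none)

/-- One subround of the leader election, after the previous flips (`sent` says whether this robot
broadcast) have been delivered. A robot that broadcast and received nothing is the leader. A robot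
that did not broadcast and received exactly one message knows that another one is the leader.
Otherwise the election goes on; a candidate that got tails and received a message drops out. -/
def electionStep (δ : ℕ) (r : Robot) (candidate sent : Bool) (inbox : List Msg) (coin : Bool) :
    Robot × Option Msg :=
  if sent = true ∧ inbox.length = 0 then (foundElected r, none)
  else if sent = false ∧ inbox.length = 1 then (foundNotElected δ r, none)
  else flip (candidate && (sent || inbox.isEmpty)) coin r

/-- An exploring robot that has seen the answer (or the absence of an answer) to its query. -/
def exploreStep (δ : ℕ) (r : Robot) (ans : Option (Option ℕ × Option ℕ × Bool)) :
    Robot × Option Msg :=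
  match ans with
  | none => ({ r with control := .started }, some .start)
  | some (x, none, false) =>
    match r.direction with
    | .forward => ({ r with direction := .backward, control := .ready r.entered }, none)
    | .backward =>
      let q := nextPort δ r.entered
      if x = some q then ({ r with control := .ready (some q) }, none)
      else ({ r with direction := .forward, control := .ready (some q) }, none)
  | some _ => ({ r with control := .ready none }, none)

/-- A returning robot that has seen the answer (or the absence of an answer) to its query. -/
def returnStep (r : Robot) (ans : Option (Option ℕ × Option ℕ × Bool)) : Robot × Option Msg :=
  match ans with
  | some (some x, none, false) =>
    ({ r with control := .ready (some x) }, some (.setChild r.entered))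
  | some (none, none, false) =>
    ({ r with
        direction := .forward
        role := .acknowledge
        entered := none
        control := .ready none }, some (.setChild r.entered))
  | _ => ({ r with control := .ready none }, none)

/-- A robot with role `acknowledge` that has seen the answer (or the absence of an answer) to
its query. -/
def acknowledgeStep (δ : ℕ) (r : Robot) (ans : Option (Option ℕ × Option ℕ × Bool)) :
    Robot × Option Msg :=
  let q := nextPort δ r.entered
  match ans with
  | some (_, y, false) =>
    if r.entered = some q then
      ({ r with direction := .backward, control := .dismissing (some q) }, some .setVisited)
    else if y = some q then ({ r with control := .dismissing (some q) }, some .setVisited)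
    else ({ r with control := .ready (some q) }, some .setVisited)
  | some (x, y, true) =>
    match r.direction with
    | .forward => ({ r with direction := .backward, control := .ready r.entered }, none)
    | .backward =>
      if x = some q then ({ r with control := .ready (some q) }, some .terminate)
      else if y = some q then
        ({ r with direction := .forward, control := .ready (some q) }, some .terminate)
      else ({ r with direction := .forward, control := .ready (some q) }, none)
  | none =>
    match r.direction with
    | .forward => ({ r with direction := .backward, control := .ready r.entered }, none)
    | .backward => ({ r with role := .done, control := .ready r.entered }, none)

/-- What a robot does in one subround: `δ` is the degree of its node, `inbox` the messages it
received in the previous subround, `coin` its random bit. -/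
def Robot.step (δ : ℕ) (r : Robot) (inbox : List Msg) (coin : Bool) : Robot × Option Msg :=
  match r.control with
  | .terminated => (r, none)
  | .begin =>
    if r.role = .done then ({ r with control := .terminated }, none)
    else ({ r with control := .asked }, some .query)
  | .asked => ({ r with control := .answer }, none)
  | .answer =>
    match r.role with
    | .explore => exploreStep δ r (answerIn inbox)
    | .ret => returnStep r (answerIn inbox)
    | .acknowledge => acknowledgeStep δ r (answerIn inbox)
    | _ => ({ r with control := .ready none }, none)
  | .started => if inbox.isEmpty then (foundAlone r, none) else flip true coin r
  | .electing candidate sent => electionStep δ r candidate sent inbox coin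
  | .dismissing p => ({ r with control := .ready p }, some .terminate)
  | .ready _ => if r.role = .settled then settledStep r inbox else (r, none)

/-! ### The system -/

/-- A port labelling: at each node, the incident edges (identified with the neighbours) are
numbered bijectively by `0, …, δ - 1`. The two port numbers of an edge are unrelated. -/
abbrev PortLabelling {V : Type*} [Fintype V] (G : SimpleGraph V) [DecidableRel G.Adj] :=
  ∀ v : V, G.neighborSet v ≃ Fin (G.degree v)

/-- Which of the messages broadcast by its co-located robots a robot receives: an arbitrary part
of them, depending arbitrarily on round, subround and robot, of at least two messages when that
many were broadcast (a robot has room for two messages). -/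
structure Reception (k : ℕ) where
  keep : (round subround : ℕ) → Fin k → List Msg → List Msg
  subperm : ∀ t s r l, (keep t s r l).Subperm l
  two_le : ∀ t s r l, min 2 l.length ≤ (keep t s r l).length

/-- A global configuration. The indices `Fin k` serve to describe the system; robots do not know
them. `out r` is the message that `r` broadcast in the previous subround of the current round;
`subround` counts the completed subrounds of the current round. -/
structure Config (V : Type*) (k : ℕ) where
  round : ℕ
  subround : ℕ
  pos : Fin k → V
  robot : Fin k → Robot
  out : Fin k → Option Msg

section System

variable {V : Type*} {k : ℕ}

/-- The configuration at the beginning of round 1: all robots are at `root`. -/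
def Config.initial (k : ℕ) (root : V) : Config V k where
  round := 1
  subround := 0
  pos := fun _ => root
  robot := fun _ => Robot.initial
  out := fun _ => none

/-- The messages broadcast in the previous subround by the other robots at the node of `r`. -/
def Config.broadcastTo [DecidableEq V] (c : Config V k) (r : Fin k) : List Msg :=
  (List.finRange k).filterMap fun r' => if r' ≠ r ∧ c.pos r' = c.pos r then c.out r' else none

/-- The robot has nothing left to do in this round, unless it receives a message. -/
def Control.finished : Control → Bool
  | .ready _ => true
  | .terminated => true
  | _ => false

/-- The communication part of the round is over: every robot has finished, and no message is
waiting to be read. -/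
def Config.Quiet (c : Config V k) : Prop :=
  ∀ r, (c.robot r).control.finished = true ∧ c.out r = none

instance (c : Config V k) : Decidable c.Quiet :=
  inferInstanceAs (Decidable (∀ r, (c.robot r).control.finished = true ∧ c.out r = none))

variable [Fintype V] [DecidableEq V] {G : SimpleGraph V} [DecidableRel G.Adj]

/-- One subround: every robot reads the messages received in the previous subround, computes, and
broadcasts. -/
def Config.communicate (G : SimpleGraph V) [DecidableRel G.Adj] (recv : Reception k) (coin : Fin k → Bool)
    (c : Config V k) : Config V k :=
  let result := fun r => (c.robot r).step (G.degree (c.pos r))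
    (recv.keep c.round c.subround r (c.broadcastTo r)) (coin r)
  { c with
    subround := c.subround + 1
    robot := fun r => (result r).1
    out := fun r => (result r).2 }

/-- The node reached from `v` via port `p`, with the port through which it is entered, if `v` has
a port `p`. -/
def traverse (port : PortLabelling G) (v : V) (p : ℕ) : Option (V × ℕ) :=
  if h : p < G.degree v then
    let w := (port v).symm ⟨p, h⟩
    some (w, port w ⟨v, w.2.symm⟩)
  else none

/-- The move of a single robot at node `v` at the end of a round: its new node and the new value
of *entered*. -/
def moveOf (port : PortLabelling G) (v : V) (r : Robot) : V × Option ℕ :=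
  match r.control with
  | .ready (some p) =>
    match traverse port v p with
    | some (w, q) => (w, some q)
    | none => (v, r.entered)
  | _ => (v, r.entered)

/-- The control state in which a robot begins the next round. -/
def Robot.nextControl (r : Robot) : Control :=
  if r.control = .terminated then .terminated
  else if r.role = .settled then .ready none
  else .begin

/-- The end of a round: all robots move, and the next round begins. -/
def Config.advance (port : PortLabelling G) (c : Config V k) : Config V k where
  round := c.round + 1
  subround := 0
  pos := fun r => (moveOf port (c.pos r) (c.robot r)).1
  robot := fun r =>
    { c.robot r with
      entered := (moveOf port (c.pos r) (c.robot r)).2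
      control := (c.robot r).nextControl }
  out := fun _ => none

/-- The execution of the algorithm from the configuration with all `k` robots at `root`. The coin
flip of robot `r` at step `s` is `ω (s, r)`. A round in which the communication never
ends is never followed by another round. -/
def exec (port : PortLabelling G) (root : V) (recv : Reception k) (ω : ℕ × Fin k → Bool) :
    ℕ → Config V k
  | 0 => Config.initial k root
  | s + 1 =>
    let c := exec port root recv ω s
    if c.Quiet then c.advance port else c.communicate G recv (fun r => ω (s, r))

/-- In the execution, round `t` is reached, and at its beginning the configuration satisfies
`A`. -/
def AtBeginning (port : PortLabelling G) (root : V) (recv : Reception k) (ω : ℕ × Fin k → Bool)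
    (t : ℕ) (A : Config V k → Prop) : Prop :=
  ∃ s, (exec port root recv ω s).round = t ∧ (exec port root recv ω s).subround = 0 ∧
    A (exec port root recv ω s)

/-- In the execution, round `t` is completed, and from its end on the configuration always
satisfies `A`. -/
def FromEndOf (port : PortLabelling G) (root : V) (recv : Reception k) (ω : ℕ × Fin k → Bool)
    (t : ℕ) (A : Config V k → Prop) : Prop :=
  ∃ s, (exec port root recv ω s).round = t + 1 ∧ (exec port root recv ω s).subround = 0 ∧
    ∀ s' ≥ s, A (exec port root recv ω s')

/-- Each node has at most one robot. -/
def Config.Dispersed (c : Config V k) : Prop :=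
  Function.Injective c.pos

/-- All robots have terminated. -/
def Config.AllTerminated (c : Config V k) : Prop :=
  ∀ r, (c.robot r).control = .terminated

/-- Each node has at most one robot, the role of `rL` is `explore`, and all other robots are
settled. -/
def Config.FirstStageOver (rL : Fin k) (c : Config V k) : Prop :=
  c.Dispersed ∧ (c.robot rL).role = .explore ∧ ∀ r, r ≠ rL → (c.robot r).role = .settled

/-- The robot `rL` is at the node `root` with role `return`. -/
def Config.BackAtRoot (root : V) (rL : Fin k) (c : Config V k) : Prop :=
  c.pos rL = root ∧ (c.robot rL).role = .ret

end System

/-- The law of independent fair coins, one for each step and each robot. -/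
noncomputable def coinMeasure (k : ℕ) : MeasureTheory.Measure (ℕ × Fin k → Bool) :=
  MeasureTheory.Measure.infinitePi fun _ => (PMF.uniformOfFintype Bool).toMeasure

end Dispersion

/-!
At the beginning of every round the execution has a simple shape (`Arrives`): a group of robots with
identical memories is at one node, and all other robots have settled, at most one at each node.
Within a round, everything that a robot hears is either a set of copies of one message (`Heard`), so
that the choice of the received part does not matter, or belongs to a leader election, for which it
only matters whether zero, one or at least two messages arrive, and this is not affected by
the choice either. Hence each round has one outcome, apart from the identity of an elected leader,
provided that elections end. They do for all coin flips in which each robot, again and again, is the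
only one with heads (`Decisive`, `Electing.exists_elected`); by the second Borel–Cantelli lemma
these are almost all coin flips (`ae_decisive`).

The exploring group therefore follows a deterministic process on the graph, `Dfs`. Its state
includes, for each node, the number `cnt` of ports by which the node has been left so far, other
than by turning round. As the ports of a node are used in cyclic order, the last of which is the
parent port, `cnt` determines the port used last. The invariant `Inv` says that the process is a
depth-first search with a stack. The process cannot run through all ports of the root before all
nodes have been visited (`Inv.cnt_lt`), and a potential increases in each round
(`Inv.potential_lt_step`), so that it comes to an empty node when only one robot is left, after `T`
rounds (`exists_stopped`). This gives `t₁ = T + 1`. The last robot then walks down the stack, and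
stores at each node of the stack the port by which that node was left last (`return_rounds`). If the
stack has length `n`, it arrives at the root at the beginning of round `t₂ = t₁ + n`.

In the second traversal the robot repeats the depth-first search round by round. The point is that
the robot settled at a node `v` is told to terminate exactly when `v` is left for the last time,
that is, when `cnt v` reaches its final value (`Inv.last_departure_iff`): at the nodes of the final
stack the last port is the stored child, at the other nodes it is the parent port. An answer is
needed only at a node that is about to be left again through a new port, and there the settled robot
is still listening; a robot that turns round does so with or without an answer (`repeat_round`).
When the traversal comes to the last, empty node, at the beginning of round `t₂ + t₁`, all settled
robots have terminated. The last robot gets no answer there, none at the node from which it came,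
and terminates after it has moved back (`fromEndOf_last_round`).
-/

namespace Dispersion

/-! ### What a robot hears -/

/-- `Heard O inbox` says that `inbox` is a possible outcome of listening when all messages that
were broadcast nearby are equal to `O` (`none`: there were no messages). -/
def Heard (O : Option Msg) (inbox : List Msg) : Prop :=
  (∀ m ∈ inbox, O = some m) ∧ (O ≠ none → inbox ≠ [])

theorem heard_none {inbox : List Msg} : Heard none inbox ↔ inbox = [] := by
  simp [Heard, List.eq_nil_iff_forall_not_mem]

theorem Heard.mem_iff {m m' : Msg} {inbox : List Msg} (h : Heard (some m) inbox) :
    m' ∈ inbox ↔ m' = m := by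
  obtain ⟨h1, h2⟩ := h
  obtain ⟨x, hx⟩ := List.exists_mem_of_ne_nil _ (h2 (by simp))
  have hx' := h1 x hx
  constructor
  · intro hm
    have := h1 m' hm
    simp_all
  · rintro rfl
    simp_all

theorem Heard.cons {m : Msg} {inbox : List Msg} (h : Heard (some m) inbox) :
    ∃ l, inbox = m :: l := by
  cases inbox with
  | nil => exact absurd rfl (h.2 (by simp))
  | cons a l =>
    have := h.1 a (by simp)
    simp only [Option.some.injEq] at this
    exact ⟨l, by rw [this]⟩

/-- The memory of a robot that has settled, between its actions: it is listening or has
terminated. -/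
structure IsSettled (m : Robot) : Prop where
  role : m.role = .settled
  control : m.control = .ready none ∨ m.control = .terminated

theorem IsSettled.step_nil {m : Robot} (h : IsSettled m) (δ : ℕ) (coin : Bool) :
    m.step δ [] coin = (m, none) := by
  rcases h.control with hc | hc
  · simp [Robot.step, hc, h.role, settledStep, childIn]
  · simp [Robot.step, hc]

theorem IsSettled.nextControl {m : Robot} (h : IsSettled m) : m.nextControl = m.control := by
  rcases h.control with hc | hc <;> simp [Robot.nextControl, hc, h.role]

theorem IsSettled.moveOf {m : Robot} (h : IsSettled m) {V : Type*} [Fintype V] {G : SimpleGraph V}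
    [DecidableRel G.Adj] (port : PortLabelling G) (v : V) :
    moveOf port v m = (v, m.entered) := by
  rcases h.control with hc | hc <;> simp [Dispersion.moveOf, hc]

section System

variable {V : Type*} {k : ℕ}

theorem Reception.mem_of_mem_keep (recv : Reception k) {t s : ℕ} {r : Fin k} {l : List Msg}
    {m : Msg} (h : m ∈ recv.keep t s r l) : m ∈ l :=
  (recv.subperm t s r l).subset h

theorem Reception.length_keep_le (recv : Reception k) (t s : ℕ) (r : Fin k) (l : List Msg) :
    (recv.keep t s r l).length ≤ l.length :=
  (recv.subperm t s r l).length_le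

theorem Reception.length_keep_eq_zero (recv : Reception k) {t s : ℕ} {r : Fin k} {l : List Msg} :
    (recv.keep t s r l).length = 0 ↔ l.length = 0 := by
  have := recv.length_keep_le t s r l
  have := recv.two_le t s r l
  omega

theorem Reception.length_keep_eq_one (recv : Reception k) {t s : ℕ} {r : Fin k} {l : List Msg} :
    (recv.keep t s r l).length = 1 ↔ l.length = 1 := by
  have := recv.length_keep_le t s r l
  have := recv.two_le t s r l
  omega

variable [DecidableEq V]

theorem Config.mem_broadcastTo {c : Config V k} {r : Fin k} {m : Msg} :
    m ∈ c.broadcastTo r ↔ ∃ r', r' ≠ r ∧ c.pos r' = c.pos r ∧ c.out r' = some m := by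
  simp only [Config.broadcastTo, List.mem_filterMap, List.mem_finRange, true_and]
  constructor
  · rintro ⟨r', h⟩
    split_ifs at h with h1
    exact ⟨r', h1.1, h1.2, h⟩
  · rintro ⟨r', h1, h2, h3⟩
    exact ⟨r', by simp [h1, h2, h3]⟩

theorem Config.heard_keep {c : Config V k} {r : Fin k} (recv : Reception k) {O : Option Msg}
    (h₁ : ∀ r', r' ≠ r → c.pos r' = c.pos r → c.out r' = none ∨ c.out r' = O)
    (h₂ : O ≠ none → ∃ r', r' ≠ r ∧ c.pos r' = c.pos r ∧ c.out r' = O) (t s : ℕ) :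
    Heard O (recv.keep t s r (c.broadcastTo r)) := by
  constructor
  · intro m hm
    obtain ⟨r', h3, h4, h5⟩ := Config.mem_broadcastTo.1 (recv.mem_of_mem_keep hm)
    rcases h₁ r' h3 h4 with h | h
    · simp [h] at h5
    · rw [← h, h5]
  · intro hO
    obtain ⟨r', h3, h4, h5⟩ := h₂ hO
    obtain ⟨m, rfl⟩ := Option.ne_none_iff_exists'.1 hO
    have : m ∈ c.broadcastTo r := Config.mem_broadcastTo.2 ⟨r', h3, h4, h5⟩
    intro hnil
    have h0 := recv.length_keep_eq_zero.1 (by rw [hnil]; rfl)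
    rw [List.length_eq_zero_iff] at h0
    simp [h0] at this

/-! ### Configurations consisting of one group and settled robots -/

/-- In round `t`, the robots in `S` are at the node `v`. All other robots have settled, at most
one at each node, and `node u` is the memory of the robot that has settled at `u`, if any. -/
structure Layout (c : Config V k) (t : ℕ) (S : Finset (Fin k)) (v : V)
    (node : V → Option Robot) : Prop where
  round : c.round = t
  pos : ∀ r ∈ S, c.pos r = v
  node_pos : ∀ r ∉ S, node (c.pos r) = some (c.robot r)
  inj : ∀ r ∉ S, ∀ r' ∉ S, c.pos r = c.pos r' → r = r'
  surj : ∀ u, node u ≠ none → ∃ r ∉ S, c.pos r = u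
  settled : ∀ u m, node u = some m → IsSettled m

/-- A layout in which all robots in `S` have the same memory `R` and have broadcast the same
message `O`, and the robot settled at their node has broadcast `O'`. -/
structure Mid (c : Config V k) (t : ℕ) (S : Finset (Fin k)) (v : V) (node : V → Option Robot)
    (R : Robot) (O O' : Option Msg) : Prop extends Layout c t S v node where
  robot : ∀ r ∈ S, c.robot r = R
  out : ∀ r ∈ S, c.out r = O
  out_settled : ∀ r ∉ S, c.out r = if c.pos r = v then O' else none
  host : node v = none → O' = none

variable {c : Config V k} {t : ℕ} {S : Finset (Fin k)} {v : V} {node : V → Option Robot}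
  {R : Robot} {O O' : Option Msg}

theorem Mid.quiet (h : Mid c t S v node R none none) (hR : R.control.finished = true) :
    c.Quiet := by
  intro r
  by_cases hr : r ∈ S
  · rw [h.robot r hr, h.out r hr]
    exact ⟨hR, rfl⟩
  · rw [h.out_settled r hr]
    refine ⟨?_, by simp⟩
    rcases (h.settled _ _ (h.node_pos r hr)).control with hc | hc <;>
      simp [hc, Control.finished]

theorem Mid.not_quiet (h : Mid c t S v node R O O') (hS : S.Nonempty)
    (hR : R.control.finished = false ∨ O ≠ none) : ¬ c.Quiet := by
  intro hq
  obtain ⟨r, hr⟩ := hS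
  have := hq r
  rw [h.robot r hr, h.out r hr] at this
  rcases hR with hR | hR
  · simp [hR] at this
  · exact hR this.2

variable [Fintype V] {G : SimpleGraph V} [DecidableRel G.Adj] {recv : Reception k}
  {coin : Fin k → Bool} {node₁ : V → Option Robot} {R₁ : Robot} {O₁ O₁' : Option Msg}

/-- Away from the node `v` of the group nothing happens in a subround. -/
theorem Layout.communicate_of_ne (h : Layout c t S v node) {r : Fin k} (hr : r ∉ S)
    (hv : c.pos r ≠ v) :
    (c.communicate G recv coin).robot r = c.robot r ∧
      (c.communicate G recv coin).out r = none := by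
  have hb : recv.keep c.round c.subround r (c.broadcastTo r) = [] := by
    rw [← heard_none]
    refine c.heard_keep recv (fun r' h1 h2 => ?_) (by simp) _ _
    by_cases hr' : r' ∈ S
    · exact absurd (h2.symm.trans (h.pos r' hr')) hv
    · exact absurd (h.inj r' hr' r hr h2) h1
  have hs := (h.settled _ _ (h.node_pos r hr)).step_nil (G.degree (c.pos r)) (coin r)
  simp [Config.communicate, hb, hs]

/-- One subround: the group hears the settled robot at its node, if the group itself is silent or
consists of one robot; the settled robot hears the group. -/
theorem Mid.communicate (h : Mid c t S v node R O O') (hS : S.Nonempty)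
    (hR : ∀ inbox b, (O = none ∨ S.card = 1 → Heard O' inbox) →
      R.step (G.degree v) inbox b = (R₁, O₁))
    (hne : ∀ u, u ≠ v → node₁ u = node u)
    (hnone : node v = none → node₁ v = none ∧ O₁' = none)
    (hsome : ∀ m, node v = some m → ∃ m₁, node₁ v = some m₁ ∧ IsSettled m₁ ∧
      ∀ inbox b, Heard O inbox → m.step (G.degree v) inbox b = (m₁, O₁')) :
    Mid (c.communicate G recv coin) t S v node₁ R₁ O₁ O₁' := by
  have hgroup : ∀ r ∈ S, (c.robot r).step (G.degree (c.pos r))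
      (recv.keep c.round c.subround r (c.broadcastTo r)) (coin r) = (R₁, O₁) := by
    intro r hr
    rw [h.robot r hr, h.pos r hr]
    refine hR _ _ fun hO => c.heard_keep recv (fun r' h1 h2 => ?_) (fun h3 => ?_) _ _
    · rw [h.pos r hr] at h2
      by_cases hr' : r' ∈ S
      · rcases hO with hO | hO
        · exact .inl (by rw [h.out r' hr', hO])
        · exact absurd (Finset.card_le_one.1 hO.le r' hr' r hr) h1
      · exact .inr (by rw [h.out_settled r' hr', if_pos h2])
    · obtain ⟨r', hr', hv⟩ := h.surj v (fun h4 => h3 (h.host h4))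
      refine ⟨r', fun h4 => hr' (h4 ▸ hr), by rw [hv, h.pos r hr], ?_⟩
      rw [h.out_settled r' hr', if_pos hv]
  have hhost : ∀ r ∉ S, c.pos r = v → ∃ m₁, node₁ v = some m₁ ∧ IsSettled m₁ ∧
      (c.robot r).step (G.degree (c.pos r))
      (recv.keep c.round c.subround r (c.broadcastTo r)) (coin r) = (m₁, O₁') := by
    intro r hr hv
    have hn := h.node_pos r hr
    rw [hv] at hn
    obtain ⟨m₁, h1, h2, h3⟩ := hsome _ hn
    refine ⟨m₁, h1, h2, ?_⟩
    rw [hv]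
    refine h3 _ _ (c.heard_keep recv (fun r' h4 h5 => ?_) (fun _ => ?_) _ _)
    · by_cases hr' : r' ∈ S
      · exact .inr (h.out r' hr')
      · exact absurd (h.inj r' hr' r hr h5) h4
    · obtain ⟨r', hr'⟩ := hS
      exact ⟨r', fun h4 => hr (h4 ▸ hr'), by rw [hv, h.pos r' hr'], h.out r' hr'⟩
  refine ⟨⟨h.round, h.pos, ?_, h.inj, ?_, ?_⟩, ?_, ?_, ?_, fun h1 => ?_⟩
  · intro r hr
    by_cases hv : c.pos r = v
    · obtain ⟨m₁, h1, h2, h3⟩ := hhost r hr hv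
      simp [Config.communicate, h3, hv, h1] 
    · rw [(h.communicate_of_ne hr hv).1]
      exact (hne _ hv).trans (h.node_pos r hr)
  · intro u hu
    refine h.surj u fun h1 => hu ?_
    by_cases hv : u = v
    · subst hv; exact (hnone h1).1
    · rw [hne u hv, h1]
  · intro u m hm
    by_cases hv : u = v
    · subst hv
      cases hn : node u with
      | none => simp [(hnone hn).1] at hm
      | some m' =>
        obtain ⟨m₁, h1, h2, -⟩ := hsome m' hn
        rw [h1] at hm
        cases hm
        exact h2
    · rw [hne u hv] at hm
      exact h.settled u m hm
  · intro r hr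
    simp [Config.communicate, hgroup r hr]
  · intro r hr
    simp [Config.communicate, hgroup r hr]
  · intro r hr
    split_ifs with hv
    · obtain ⟨m₁, h1, h2, h3⟩ := hhost r hr hv
      simp [Config.communicate, h3]
    · exact (h.communicate_of_ne hr hv).2
  · cases hn : node v with
    | none => exact (hnone hn).2
    | some m =>
      obtain ⟨m₁, h2, -⟩ := hsome m hn
      simp [h1] at h2

/-- A subround in which the group was silent before: settled robots do nothing. -/
theorem Mid.communicate_of_silent (h : Mid c t S v node R none O') (hS : S.Nonempty)
    (hR : ∀ inbox b, Heard O' inbox → R.step (G.degree v) inbox b = (R₁, O₁)) :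
    Mid (c.communicate G recv coin) t S v node R₁ O₁ none := by
  refine h.communicate hS (fun inbox b hi => hR inbox b (hi (.inl rfl))) (fun _ _ => rfl)
    (fun h1 => ⟨h1, rfl⟩) fun m hm => ⟨m, hm, h.settled v m hm, fun inbox b hi => ?_⟩
  rw [heard_none.1 hi]
  exact (h.settled v m hm).step_nil _ _

/-- The answer that a query at a node gets, by the memory of the robot settled there. -/
def replyOf : Option Robot → Option (Option ℕ × Option ℕ × Bool)
  | none => none
  | some m => if m.control = .terminated then none else some (m.parent, m.child, m.visited)

/-- An answer as a message. -/
def infoOf : Option (Option ℕ × Option ℕ × Bool) → Option Msg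
  | none => none
  | some a => some (.info a.1 a.2.1 a.2.2)

theorem Heard.answerIn {a : Option (Option ℕ × Option ℕ × Bool)} {inbox : List Msg}
    (h : Heard (infoOf a) inbox) : answerIn inbox = a := by
  cases a with
  | none => rw [heard_none.1 h]; rfl
  | some a =>
    obtain ⟨l, rfl⟩ := h.cons
    rfl

/-- A subround in which no listening robot is settled at the node of the group. -/
theorem Mid.communicate_of_unhosted (h : Mid c t S v node R O O') (hS : S.Nonempty)
    (hv : replyOf (node v) = none)
    (hR : ∀ inbox b, (O = none ∨ S.card = 1 → Heard O' inbox) →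
      R.step (G.degree v) inbox b = (R₁, O₁)) :
    Mid (c.communicate G recv coin) t S v node R₁ O₁ none := by
  refine h.communicate hS hR (fun _ _ => rfl)
    (fun h1 => ⟨h1, rfl⟩) fun m hm => ⟨m, hm, h.settled v m hm, fun inbox b hi => ?_⟩
  have : m.control = .terminated := by
    simpa [hm, replyOf] using hv
  simp [Robot.step, this]

/-- At the end of a round the group moves and the settled robots stay. -/
theorem Mid.advance (h : Mid c t S v node R none none) (port : PortLabelling G) :
    Mid (c.advance port) (t + 1) S (moveOf port v R).1 node
      { R with entered := (moveOf port v R).2, control := R.nextControl } none none := by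
  have hpos : ∀ r ∉ S, (c.advance port).pos r = c.pos r := fun r hr => by
    simp [Config.advance, (h.settled _ _ (h.node_pos r hr)).moveOf port]
  have hrob : ∀ r ∉ S, (c.advance port).robot r = c.robot r := fun r hr => by
    have := h.settled _ _ (h.node_pos r hr)
    simp [Config.advance, this.moveOf port, this.nextControl]
  refine ⟨⟨by simp [Config.advance, h.round], ?_, ?_, ?_, ?_, h.settled⟩, ?_, ?_, ?_, fun _ => rfl⟩
  · intro r hr
    simp [Config.advance, h.pos r hr, h.robot r hr]
  · intro r hr
    rw [hpos r hr, hrob r hr, h.node_pos r hr]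
  · intro r hr r' hr'
    rw [hpos r hr, hpos r' hr']
    exact h.inj r hr r' hr'
  · intro u hu
    obtain ⟨r, hr, h1⟩ := h.surj u hu
    exact ⟨r, hr, by rw [hpos r hr, h1]⟩
  · intro r hr
    simp [Config.advance, h.pos r hr, h.robot r hr]
  · intro r hr
    simp [Config.advance]
  · intro r hr
    exact (ite_self none).symm

end System

/-! ### Rounds without an election -/

/-- The memory, at the beginning of a round, of a robot that has not settled. -/
def lead (role : Role) (ent : Option ℕ) (dir : Direction) : Robot :=
  ⟨role, ent, dir, none, none, false, .begin⟩

/-- The memory of a settled robot with parent `x`, child `y` and *visited* `b`. -/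
def host (x y : Option ℕ) (b : Bool) (control : Control) : Robot :=
  ⟨.settled, x, .forward, x, y, b, control⟩

section Rounds

variable {V : Type*} {k : ℕ} [Fintype V] [DecidableEq V] {G : SimpleGraph V} [DecidableRel G.Adj]

/-- Round `t` is reached, and at its beginning the group `S` is at `v` with memory `R`, while all
other robots have settled as described by `node`. -/
def Arrives (port : PortLabelling G) (root : V) (recv : Reception k) (ω : ℕ × Fin k → Bool)
    (t : ℕ) (S : Finset (Fin k)) (v : V) (node : V → Option Robot) (R : Robot) : Prop :=
  ∃ s, (exec port root recv ω s).subround = 0 ∧ Mid (exec port root recv ω s) t S v node R none none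

variable {port : PortLabelling G} {root : V} {recv : Reception k} {ω : ℕ × Fin k → Bool}
  {s t : ℕ} {S : Finset (Fin k)} {v w : V} {node : V → Option Robot} {R R₁ : Robot}
  {O O' O₁ : Option Msg} {x y e : Option ℕ} {b : Bool} {m m₁ : Robot} {p p' : ℕ} {d : Direction}

theorem exec_succ_of_quiet (h : (exec port root recv ω s).Quiet) :
    exec port root recv ω (s + 1) = (exec port root recv ω s).advance port := by
  simp [exec, h]

theorem exec_succ_of_not_quiet (h : ¬ (exec port root recv ω s).Quiet) :
    exec port root recv ω (s + 1) =
      (exec port root recv ω s).communicate G recv fun r => ω (s, r) := by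
  simp [exec, h]

/-- The first three subrounds of a round: the group asks a query and reads the answer. -/
theorem Arrives.respond (h : Arrives port root recv ω t S v node R) (hS : S.Nonempty)
    (hb : R.control = .begin) (hd : R.role ≠ .done)
    (hresp : ∀ inbox b, answerIn inbox = replyOf (node v) →
      { R with control := .answer }.step (G.degree v) inbox b = (R₁, O₁)) :
    ∃ s, Mid (exec port root recv ω s) t S v node R₁ O₁ none := by
  obtain ⟨s, -, h⟩ := h
  have h1 : Mid (exec port root recv ω (s + 1)) t S v node { R with control := .asked }
      (some .query) none := by
    rw [exec_succ_of_not_quiet (h.not_quiet hS (.inl (by simp [hb, Control.finished])))]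
    exact h.communicate_of_silent hS fun inbox b _ => by simp [Robot.step, hb, hd]
  have h2 : Mid (exec port root recv ω (s + 1 + 1)) t S v node { R with control := .answer }
      none (infoOf (replyOf (node v))) := by
    rw [exec_succ_of_not_quiet (h1.not_quiet hS (.inr (by simp)))]
    refine h1.communicate hS (fun inbox b _ => by simp [Robot.step]) (fun _ _ => rfl)
      (fun hn => ⟨hn, by simp [hn, replyOf, infoOf]⟩) fun m hm => ⟨m, hm, h.settled v m hm, ?_⟩
    intro inbox b hi
    have hm' := h.settled v m hm
    rcases hm'.control with hc | hc
    · simp [Robot.step, hc, hm'.role, settledStep, hi.mem_iff, hm, replyOf, infoOf]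
    · simp [Robot.step, hc, hm, replyOf, infoOf]
  refine ⟨s + 1 + 1 + 1, ?_⟩
  rw [exec_succ_of_not_quiet (h2.not_quiet hS (.inl (by simp [Control.finished])))]
  exact h2.communicate_of_silent hS fun inbox b hi => hresp inbox b hi.answerIn

/-- A message of the group is delivered to the robot that has settled at its node. -/
theorem Mid.deliver {msg : Msg}
    (h : Mid (exec port root recv ω s) t S v node R (some msg) O') (hS : S.Nonempty)
    (hR : ∀ inbox b, R.step (G.degree v) inbox b = (R₁, O₁))
    (hm : node v = some m) (hm₁ : IsSettled m₁)
    (hstep : ∀ inbox b, Heard (some msg) inbox → m.step (G.degree v) inbox b = (m₁, none)) :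
    Mid (exec port root recv ω (s + 1)) t S v (Function.update node v (some m₁)) R₁ O₁ none := by
  rw [exec_succ_of_not_quiet (h.not_quiet hS (.inr (by simp)))]
  refine h.communicate hS (fun inbox b _ => hR inbox b)
    (fun u hu => Function.update_of_ne hu _ _) (fun hn => by simp [hn] at hm) fun m' hm' => ?_
  rw [hm] at hm'
  cases hm'
  exact ⟨m₁, by simp, hm₁, hstep⟩

theorem Mid.leave (h : Mid (exec port root recv ω s) t S v node R none none)
    (hR : R.control = .ready (some p)) (hrole : R.role ≠ .settled)
    (hp : traverse port v p = some (w, p')) :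
    Arrives port root recv ω (t + 1) S w node
      { R with entered := some p', control := .begin } := by
  refine ⟨s + 1, ?_⟩
  rw [exec_succ_of_quiet (h.quiet (by simp [hR, Control.finished]))]
  refine ⟨rfl, ?_⟩
  have := h.advance port
  simpa [moveOf, hR, hp, Robot.nextControl, hrole] using this

theorem Mid.stay (h : Mid (exec port root recv ω s) t S v node R none none)
    (hR : R.control = .ready none) (hrole : R.role ≠ .settled) :
    Arrives port root recv ω (t + 1) S v node { R with control := .begin } := by
  refine ⟨s + 1, ?_⟩
  rw [exec_succ_of_quiet (h.quiet (by simp [hR, Control.finished]))]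
  refine ⟨rfl, ?_⟩
  have := h.advance port
  simpa [moveOf, hR, Robot.nextControl, hrole] using this

theorem isSettled_host (x y : Option ℕ) (b : Bool) : IsSettled (host x y b (.ready none)) :=
  ⟨rfl, .inl rfl⟩

theorem isSettled_host_terminated (x y : Option ℕ) (b : Bool) :
    IsSettled (host x y b .terminated) :=
  ⟨rfl, .inr rfl⟩

theorem explore_forward
    (h : Arrives port root recv ω t S v node (lead .explore (some p) .forward)) (hS : S.Nonempty)
    (hv : replyOf (node v) = some (x, none, false)) (hp : traverse port v p = some (w, p')) :
    Arrives port root recv ω (t + 1) S w node (lead .explore (some p') .backward) := by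
  obtain ⟨s, hs⟩ := h.respond (R₁ := ⟨.explore, some p, .backward, none, none, false,
    .ready (some p)⟩) (O₁ := none) hS rfl (by simp [lead]) fun inbox b h1 => by
      simp [Robot.step, lead, h1, hv, exploreStep]
  exact hs.leave rfl (by simp) hp

theorem explore_backward
    (h : Arrives port root recv ω t S v node (lead .explore e .backward)) (hS : S.Nonempty)
    (hv : replyOf (node v) = some (x, none, false))
    (hp : traverse port v (nextPort (G.degree v) e) = some (w, p')) :
    Arrives port root recv ω (t + 1) S w node (lead .explore (some p')
      (if x = some (nextPort (G.degree v) e) then .backward else .forward)) := by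
  obtain ⟨s, hs⟩ := h.respond (R₁ := ⟨.explore, e,
    (if x = some (nextPort (G.degree v) e) then .backward else .forward), none, none, false,
    .ready (some (nextPort (G.degree v) e))⟩) (O₁ := none) hS rfl (by simp [lead])
    fun inbox b h1 => by
      by_cases hx : x = some (nextPort (G.degree v) e) <;>
        simp [Robot.step, lead, h1, hv, exploreStep, hx]
  exact hs.leave rfl (by simp) hp

theorem explore_alone
    (h : Arrives port root recv ω t S v node (lead .explore (some p) d)) (hS : S.card = 1)
    (hv : node v = none) (hp : traverse port v p = some (w, p')) :
    Arrives port root recv ω (t + 1) S w node (lead .ret (some p') d) := by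
  have hS' : S.Nonempty := Finset.card_pos.1 (by omega)
  have hv' : replyOf (node v) = none := by rw [hv]; rfl
  obtain ⟨s, hs⟩ := h.respond (R₁ := ⟨.explore, some p, d, none, none, false, .started⟩)
    (O₁ := some .start) hS' rfl (by simp [lead]) fun inbox b h1 => by
      simp [Robot.step, lead, h1, hv', exploreStep]
  have h2 : Mid (exec port root recv ω (s + 1)) t S v node
      ⟨.ret, some p, d, none, none, false, .ready (some p)⟩ none none := by
    rw [exec_succ_of_not_quiet (hs.not_quiet hS' (.inr (by simp)))]
    refine hs.communicate_of_unhosted hS' hv' fun inbox b hi => ?_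
    rw [heard_none.1 (hi (.inr hS))]
    rfl
  exact h2.leave rfl (by simp) hp

/-- A returning robot leaves a message at each node on its way. -/
theorem return_step
    (h : Arrives port root recv ω t S v node (lead .ret e d)) (hS : S.Nonempty)
    (hv : node v = some (host (some p) none false (.ready none)))
    (hp : traverse port v p = some (w, p')) :
    Arrives port root recv ω (t + 1) S w
      (Function.update node v (some (host (some p) e false (.ready none))))
      (lead .ret (some p') d) := by
  obtain ⟨s, hs⟩ := h.respond (R₁ := ⟨.ret, e, d, none, none, false, .ready (some p)⟩)
    (O₁ := some (.setChild e)) hS rfl (by simp [lead]) fun inbox b h1 => by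
      simp [Robot.step, lead, h1, hv, replyOf, host, returnStep]
  refine (hs.deliver hS (O₁ := none) (fun inbox b => by simp [Robot.step]; rfl) hv
    (isSettled_host _ e _) fun inbox b hi => ?_).leave rfl (by simp) hp
  obtain ⟨l, rfl⟩ := hi.cons
  simp only [Robot.step, host, settledStep, if_true, hi.mem_iff]
  simp [childIn]

theorem return_root
    (h : Arrives port root recv ω t S v node (lead .ret e d)) (hS : S.Nonempty)
    (hv : node v = some (host none none false (.ready none))) :
    Arrives port root recv ω (t + 1) S v
      (Function.update node v (some (host none e false (.ready none))))
      (lead .acknowledge none .forward) := by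
  obtain ⟨s, hs⟩ := h.respond
    (R₁ := ⟨.acknowledge, none, .forward, none, none, false, .ready none⟩)
    (O₁ := some (.setChild e)) hS rfl (by simp [lead]) fun inbox b h1 => by
      simp [Robot.step, lead, h1, hv, replyOf, host, returnStep]
  refine (hs.deliver hS (O₁ := none) (fun inbox b => by simp [Robot.step]; rfl) hv
    (isSettled_host _ e _) fun inbox b hi => ?_).stay rfl (by simp)
  obtain ⟨l, rfl⟩ := hi.cons
  simp only [Robot.step, host, settledStep, if_true, hi.mem_iff]
  simp [childIn]

theorem childIn_of_heard {msg : Msg} {inbox : List Msg} (h : Heard (some msg) inbox)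
    (hmsg : ∀ x, msg ≠ .setChild x) : childIn inbox = none := by
  rw [childIn, List.findSome?_eq_none_iff]
  intro m hm
  rw [h.mem_iff] at hm
  subst hm
  cases m <;> simp_all

/-- The first visit of the acknowledging robot to a node. -/
theorem acknowledge_first
    (h : Arrives port root recv ω t S v node (lead .acknowledge e d)) (hS : S.Nonempty)
    (hv : node v = some (host x y false (.ready none)))
    (hp : traverse port v (nextPort (G.degree v) e) = some (w, p')) :
    Arrives port root recv ω (t + 1) S w
      (Function.update node v (some (host x y true
        (if e = some (nextPort (G.degree v) e) ∨ y = some (nextPort (G.degree v) e)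
          then .terminated else .ready none))))
      (lead .acknowledge (some p')
        (if e = some (nextPort (G.degree v) e) then .backward else d)) := by
  have hvis : ∀ inbox (b : Bool), Heard (some .setVisited) inbox →
      (host x y false (.ready none)).step (G.degree v) inbox b =
        (host x y true (.ready none), none) := fun inbox b hi => by
    simp [Robot.step, host, settledStep, hi.mem_iff, childIn_of_heard hi]
  have hter : ∀ inbox (b : Bool), Heard (some .terminate) inbox →
      (host x y true (.ready none)).step (G.degree v) inbox b =
        (host x y true .terminated, none) := fun inbox b hi => by
    simp [Robot.step, host, settledStep, hi.mem_iff, childIn_of_heard hi]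
  set q := nextPort (G.degree v) e with hq
  by_cases hterm : e = some q ∨ y = some q
  · obtain ⟨s, hs⟩ := h.respond (R₁ := ⟨.acknowledge, e, (if e = some q then .backward else d),
      none, none, false, .dismissing (some q)⟩)
      (O₁ := some .setVisited) hS rfl (by simp [lead]) fun inbox b h1 => by
        by_cases h2 : e = some q
        · simp [Robot.step, lead, h1, hv, replyOf, host, acknowledgeStep, ← hq, if_pos h2]
        · simp [Robot.step, lead, h1, hv, replyOf, host, acknowledgeStep, ← hq, if_neg h2,
            hterm.resolve_left h2]
    have h2 := hs.deliver (R₁ := ⟨.acknowledge, e, (if e = some q then .backward else d),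
      none, none, false, .ready (some q)⟩) (O₁ := some .terminate) hS
      (fun inbox b => by simp [Robot.step]) hv (isSettled_host x y true) hvis
    have h3 := h2.deliver (O₁ := none) hS
      (fun inbox b => by simp [Robot.step]; rfl) (Function.update_self _ _ _)
      (isSettled_host_terminated x y true) hter
    rw [Function.update_idem] at h3
    rw [if_pos hterm]
    exact h3.leave rfl (by simp) hp
  · obtain ⟨s, hs⟩ := h.respond (R₁ := ⟨.acknowledge, e, d,
      none, none, false, .ready (some q)⟩)
      (O₁ := some .setVisited) hS rfl (by simp [lead]) fun inbox b h1 => by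
        push Not at hterm
        simp [Robot.step, lead, h1, hv, replyOf, host, acknowledgeStep, ← hq, hterm.1, hterm.2]
    have h2 := hs.deliver (O₁ := none) hS
      (fun inbox b => by simp [Robot.step]; rfl) hv (isSettled_host x y true) hvis
    rw [if_neg hterm, if_neg fun h3 => hterm (.inl h3)]
    exact h2.leave rfl (by simp) hp

/-- The acknowledging robot, moving forward, turns round at a node that it has visited before,
whether or not the robot settled there is still listening. -/
theorem acknowledge_forward
    (h : Arrives port root recv ω t S v node (lead .acknowledge (some p) .forward))
    (hS : S.Nonempty)
    (hv : replyOf (node v) = none ∨ ∃ x y, replyOf (node v) = some (x, y, true))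
    (hp : traverse port v p = some (w, p')) :
    Arrives port root recv ω (t + 1) S w node (lead .acknowledge (some p') .backward) := by
  obtain ⟨s, hs⟩ := h.respond (R₁ := ⟨.acknowledge, some p, .backward, none, none, false,
    .ready (some p)⟩) (O₁ := none) hS rfl (by simp [lead]) fun inbox b h1 => by
      rcases hv with hv | ⟨x, y, hv⟩ <;>
        simp [Robot.step, lead, h1, hv, acknowledgeStep]
  exact hs.leave rfl (by simp) hp

theorem acknowledge_backward
    (h : Arrives port root recv ω t S v node (lead .acknowledge e .backward)) (hS : S.Nonempty)
    (hv : node v = some (host x y true (.ready none)))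
    (hp : traverse port v (nextPort (G.degree v) e) = some (w, p')) :
    Arrives port root recv ω (t + 1) S w
      (Function.update node v (some (host x y true
        (if x = some (nextPort (G.degree v) e) ∨ y = some (nextPort (G.degree v) e)
          then .terminated else .ready none))))
      (lead .acknowledge (some p')
        (if x = some (nextPort (G.degree v) e) then .backward else .forward)) := by
  have hter : ∀ inbox (b : Bool), Heard (some .terminate) inbox →
      (host x y true (.ready none)).step (G.degree v) inbox b =
        (host x y true .terminated, none) := fun inbox b hi => by
    simp [Robot.step, host, settledStep, hi.mem_iff, childIn_of_heard hi]
  set q := nextPort (G.degree v) e with hq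
  by_cases hterm : x = some q ∨ y = some q
  · obtain ⟨s, hs⟩ := h.respond (R₁ := ⟨.acknowledge, e,
      (if x = some q then .backward else .forward), none, none, false, .ready (some q)⟩)
      (O₁ := some .terminate) hS rfl (by simp [lead]) fun inbox b h1 => by
        by_cases h2 : x = some q
        · simp [Robot.step, lead, h1, hv, replyOf, host, acknowledgeStep, ← hq, if_pos h2]
        · simp [Robot.step, lead, h1, hv, replyOf, host, acknowledgeStep, ← hq, if_neg h2,
            hterm.resolve_left h2]
    have h3 := hs.deliver (O₁ := none) hS
      (fun inbox b => by simp [Robot.step]; rfl) hv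
      (isSettled_host_terminated x y true) hter
    rw [if_pos hterm]
    exact h3.leave rfl (by simp) hp
  · obtain ⟨s, hs⟩ := h.respond (R₁ := ⟨.acknowledge, e, .forward,
      none, none, false, .ready (some q)⟩) (O₁ := none) hS rfl (by simp [lead])
      fun inbox b h1 => by
        push Not at hterm
        simp [Robot.step, lead, h1, hv, replyOf, host, acknowledgeStep, ← hq, hterm.1, hterm.2]
    rw [if_neg hterm, if_neg fun h3 => hterm (.inl h3), ← hv, Function.update_eq_self]
    exact hs.leave rfl (by simp) hp

/-- The acknowledging robot becomes done when it turns round at an empty node and then comes back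
to a node where it gets no answer. -/
theorem acknowledge_done
    (h : Arrives port root recv ω t S v node (lead .acknowledge (some p) .backward))
    (hS : S.Nonempty) (hv : replyOf (node v) = none) (hp : traverse port v p = some (w, p')) :
    Arrives port root recv ω (t + 1) S w node (lead .done (some p') .backward) := by
  obtain ⟨s, hs⟩ := h.respond (R₁ := ⟨.done, some p, .backward, none, none, false,
    .ready (some p)⟩) (O₁ := none) hS rfl (by simp [lead]) fun inbox b h1 => by
      simp [Robot.step, lead, h1, hv, acknowledgeStep]
  exact hs.leave rfl (by simp) hp

theorem done_terminates
    (h : Arrives port root recv ω t S v node (lead .done e d)) (hS : S.Nonempty) :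
    Arrives port root recv ω (t + 1) S v node { lead .done e d with control := .terminated } := by
  obtain ⟨s, -, h⟩ := h
  have h1 : Mid (exec port root recv ω (s + 1)) t S v node
      { lead .done e d with control := .terminated } none none := by
    rw [exec_succ_of_not_quiet (h.not_quiet hS (.inl (by simp [lead, Control.finished])))]
    exact h.communicate_of_silent hS fun inbox b _ => by simp [Robot.step, lead]
  refine ⟨s + 1 + 1, ?_⟩
  rw [exec_succ_of_quiet (h1.quiet rfl)]
  exact ⟨rfl, h1.advance port⟩

end Rounds

/-! ### Leader election -/

section Election

variable {V : Type*} {k : ℕ} [DecidableEq V]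

/-- The group `S` is electing a leader at the node `v`: `C` is the set of candidates, and `B` the
set of those that have just broadcast `heads`. -/
structure Electing (c : Config V k) (t : ℕ) (S : Finset (Fin k)) (v : V)
    (node : V → Option Robot) (L : Robot) (C B : Finset (Fin k)) : Prop
    extends Layout c t S v node where
  robot : ∀ r ∈ S, c.robot r = { L with control := .electing (decide (r ∈ C)) (decide (r ∈ B)) }
  out : ∀ r ∈ S, c.out r = if r ∈ B then some .heads else none
  out_settled : ∀ r ∉ S, c.out r = none
  candidates_subset : C ⊆ S
  senders_subset : B ⊆ C

/-- Some sequence of coin flips that ends every election: each robot, again and again, is the only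
one that gets heads. -/
def Decisive (ω : ℕ × Fin k → Bool) : Prop :=
  ∀ (r : Fin k) (s : ℕ), ∃ s' ≥ s, ∀ r', ω (s', r') = decide (r' = r)

variable [Fintype V] {G : SimpleGraph V} [DecidableRel G.Adj]
  {c : Config V k} {recv : Reception k} {coin : Fin k → Bool}
  {port : PortLabelling G} {root : V} {ω : ℕ × Fin k → Bool}
  {s t : ℕ} {S C B : Finset (Fin k)} {v w : V} {node : V → Option Robot} {L : Robot}
  {e : Option ℕ} {p' : ℕ} {d : Direction}

omit [Fintype V] in
theorem Electing.length_broadcastTo (h : Electing c t S v node L C B) {r : Fin k} (hr : r ∈ S) :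
    (c.broadcastTo r).length = (B.erase r).card := by
  have hB := h.senders_subset.trans h.candidates_subset
  rw [Config.broadcastTo, List.length_filterMap_eq_countP, List.countP_eq_length_filter,
    ← List.toFinset_card_of_nodup ((List.nodup_finRange k).filter _)]
  congr 1
  ext r'
  simp only [List.mem_toFinset, List.mem_filter, List.mem_finRange, true_and, Finset.mem_erase]
  by_cases hr' : r' ∈ S
  · by_cases hb : r' ∈ B <;> simp [h.pos r hr, h.pos r' hr', h.out r' hr', hb]
  · have : r' ∉ B := fun h1 => hr' (hB h1)
    simp [h.out_settled r' hr', this]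

theorem Layout.communicate (h : Layout c t S v node) (hv : node v = none) :
    Layout (c.communicate G recv coin) t S v node ∧
      ∀ r ∉ S, (c.communicate G recv coin).out r = none := by
  have hne : ∀ r ∉ S, c.pos r ≠ v := fun r hr h1 => by
    have := h.node_pos r hr
    simp [h1, hv] at this
  refine ⟨⟨h.round, h.pos, fun r hr => ?_, h.inj, h.surj, h.settled⟩, fun r hr => ?_⟩
  · rw [(h.communicate_of_ne hr (hne r hr)).1]
    exact h.node_pos r hr
  · exact (h.communicate_of_ne hr (hne r hr)).2

theorem Electing.communicate (h : Electing c t S v node L C B) (hv : node v = none)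
    (hB : B.card ≠ 1) :
    Electing (c.communicate G recv coin) t S v node L (if B = ∅ then C else B)
      ((if B = ∅ then C else B).filter fun r => coin r = true) := by
  obtain ⟨h1, h2⟩ := h.toLayout.communicate (G := G) (recv := recv) (coin := coin) hv
  have hsub : (if B = ∅ then C else B) ⊆ S := by
    split_ifs
    · exact h.candidates_subset
    · exact h.senders_subset.trans h.candidates_subset
  have key : ∀ r ∈ S, (c.robot r).step (G.degree (c.pos r))
      (recv.keep c.round c.subround r (c.broadcastTo r)) (coin r) =
      flip (decide (r ∈ if B = ∅ then C else B)) (coin r) L := by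
    intro r hr
    have hlen := h.length_broadcastTo hr
    rw [h.robot r hr]
    generalize hl : recv.keep c.round c.subround r (c.broadcastTo r) = inbox
    have h0 : inbox.length = 0 ↔ (B.erase r).card = 0 := by
      rw [← hl, recv.length_keep_eq_zero, hlen]
    have h3 : inbox.length = 1 ↔ (B.erase r).card = 1 := by
      rw [← hl, recv.length_keep_eq_one, hlen]
    have h4 : inbox.isEmpty = decide ((B.erase r).card = 0) := by
      rw [Bool.eq_iff_iff, decide_eq_true_iff, ← h0]
      simp
    simp only [Robot.step, electionStep]
    by_cases hrB : r ∈ B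
    · have hpos := Finset.card_pos.2 ⟨r, hrB⟩
      rw [Finset.card_erase_of_mem hrB] at h0
      rw [if_neg (by simp only [hrB, decide_true, true_and]; omega), if_neg (by simp [hrB])]
      have hne : B ≠ ∅ := Finset.ne_empty_of_mem hrB
      simp [flip, hrB, hne, h.senders_subset hrB]
    · rw [Finset.erase_eq_of_notMem hrB] at h3 h4
      rw [if_neg (by simp [hrB]), if_neg (by simp only [hrB, decide_false, true_and]; omega)]
      by_cases hne : B = ∅
      · simp [flip, h4, hne]
      · have : B.card ≠ 0 := by simpa using hne
        simp [flip, h4, hne, hrB]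
  refine ⟨h1, fun r hr => ?_, fun r hr => ?_, h2, hsub, Finset.filter_subset _ _⟩
  · simp only [Config.communicate, key r hr, flip, Finset.mem_filter]
    simp
  · simp only [Config.communicate, key r hr, flip, Finset.mem_filter]
    simp

/-- When exactly one robot broadcasts, it settles and the others learn that they have not been
elected. -/
theorem Electing.communicate_elected {r₀ : Fin k} (h : Electing c t S v node L C {r₀})
    (hv : node v = none) :
    Mid (c.communicate G recv coin) t (S.erase r₀) v (Function.update node v (foundElected L))
      (foundNotElected (G.degree v) L) none none := by
  obtain ⟨h1, h2⟩ := h.toLayout.communicate (G := G) (recv := recv) (coin := coin) hv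
  have hr₀ : r₀ ∈ S := h.candidates_subset (h.senders_subset (by simp))
  have key₀ : (c.robot r₀).step (G.degree (c.pos r₀))
      (recv.keep c.round c.subround r₀ (c.broadcastTo r₀)) (coin r₀) = (foundElected L, none) := by
    have hlen := h.length_broadcastTo hr₀
    have h0 := (recv.length_keep_eq_zero (t := c.round) (s := c.subround) (r := r₀)).2
      (by rw [hlen]; simp)
    rw [h.robot r₀ hr₀]
    simp only [Robot.step, electionStep]
    rw [if_pos ⟨by simp, h0⟩]
    rfl
  have key : ∀ r ∈ S.erase r₀, (c.robot r).step (G.degree (c.pos r))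
      (recv.keep c.round c.subround r (c.broadcastTo r)) (coin r) =
      (foundNotElected (G.degree v) L, none) := by
    intro r hr
    obtain ⟨hr, hrS⟩ := Finset.mem_erase.1 hr
    have hlen := h.length_broadcastTo hrS
    have h0 := (recv.length_keep_eq_one (t := c.round) (s := c.subround) (r := r)).2
      (by rw [hlen, Finset.erase_eq_of_notMem (by simpa using hr)]; simp)
    rw [h.robot r hrS, h.pos r hrS]
    simp only [Robot.step, electionStep]
    rw [if_neg (by simp [hr]), if_pos ⟨by simp [hr], h0⟩]
    rfl
  have hnot : ∀ r, r ∉ S.erase r₀ → r = r₀ ∨ r ∉ S := fun r hr => by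
    by_contra! h3
    exact hr (Finset.mem_erase.2 h3)
  have hpos : ∀ r ∉ S, c.pos r ≠ v := fun r hr h3 => by
    have := h.node_pos r hr
    simp [h3, hv] at this
  refine ⟨⟨h.round, fun r hr => h.pos r (Finset.mem_of_mem_erase hr), ?_, ?_, ?_, ?_⟩, ?_, ?_, ?_,
    fun _ => rfl⟩
  · intro r hr
    rcases hnot r hr with rfl | hr
    · simp [Config.communicate, key₀, h.pos r hr₀]
    · rw [← h1.node_pos r hr]
      exact Function.update_of_ne (hpos r hr) _ _
  · intro r hr r' hr' hrr'
    change c.pos r = c.pos r' at hrr'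
    rcases hnot r hr with h3 | h3 <;> rcases hnot r' hr' with h4 | h4
    · rw [h3, h4]
    · exact absurd (hrr'.symm.trans (h3 ▸ h.pos _ hr₀)) (hpos _ h4)
    · exact absurd (hrr'.trans (h4 ▸ h.pos _ hr₀)) (hpos _ h3)
    · exact h.inj r h3 r' h4 hrr'
  · intro u hu
    by_cases huv : u = v
    · exact ⟨r₀, by simp, by rw [huv]; exact h.pos r₀ hr₀⟩
    · rw [Function.update_of_ne huv] at hu
      obtain ⟨r, hr, h3⟩ := h.surj u hu
      exact ⟨r, fun h4 => hr (Finset.mem_of_mem_erase h4), h3⟩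
  · intro u m hm
    by_cases huv : u = v
    · subst huv
      simp only [Function.update_self, Option.some.injEq] at hm
      subst hm
      exact ⟨rfl, .inl rfl⟩
    · rw [Function.update_of_ne huv] at hm
      exact h.settled u m hm
  · intro r hr
    simp [Config.communicate, key r hr]
  · intro r hr
    simp [Config.communicate, key r hr]
  · intro r hr
    rw [ite_self]
    rcases hnot r hr with rfl | hr
    · simp [Config.communicate, key₀]
    · exact h2 r hr

omit [DecidableEq V] [Fintype V] in
theorem Electing.not_quiet (h : Electing c t S v node L C B) (hC : C.Nonempty) : ¬ c.Quiet := by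
  intro hq
  obtain ⟨r, hr⟩ := hC
  have := (hq r).1
  simp [h.robot r (h.candidates_subset hr), Control.finished] at this

/-- With decisive coin flips an election ends. The set of candidates can only shrink; as long as it
does not, a candidate `r` remains one until it is the only robot with heads. -/
theorem Electing.exists_elected (hω : Decisive ω) (hv : node v = none)
    (h : Electing (exec port root recv ω s) t S v node L C B) (hC : C.Nonempty) :
    ∃ s' r₀ C', Electing (exec port root recv ω s') t S v node L C' {r₀} := by
  induction hn : C.card using Nat.strong_induction_on generalizing s C B with
  | _ n ih =>
    obtain ⟨r, hr⟩ := hC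
    obtain ⟨s₁, hs₁, hcoin⟩ := hω r s
    obtain ⟨j, rfl⟩ := Nat.exists_eq_add_of_le hs₁
    clear hs₁
    induction j generalizing s B with
    | zero =>
      by_cases hB : B.card = 1
      · obtain ⟨r₀, rfl⟩ := Finset.card_eq_one.1 hB
        exact ⟨s, r₀, C, h⟩
      have h1 := h.communicate (G := G) (recv := recv) (coin := fun r => ω (s, r)) hv hB
      rw [← exec_succ_of_not_quiet (h.not_quiet ⟨r, hr⟩)] at h1
      by_cases hlt : (if B = ∅ then C else B).card < n
      · refine ih _ hlt h1 ?_ rfl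
        split_ifs with h2
        · exact ⟨r, hr⟩
        · exact Finset.nonempty_iff_ne_empty.2 h2
      · have hC' : (if B = ∅ then C else B) = C := by
          split_ifs with h2
          · rfl
          · rw [if_neg h2] at hlt
            exact Finset.eq_of_subset_of_card_le h.senders_subset (by omega)
        rw [hC'] at h1
        refine ⟨s + 1, r, C, ?_⟩
        convert h1
        ext r'
        simp only [Finset.mem_singleton, Finset.mem_filter]
        have := hcoin r'
        rw [add_zero] at this
        rw [this, decide_eq_true_iff]
        exact ⟨fun h3 => ⟨h3 ▸ hr, h3⟩, fun h3 => h3.2⟩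
    | succ j ihj =>
      by_cases hB : B.card = 1
      · obtain ⟨r₀, rfl⟩ := Finset.card_eq_one.1 hB
        exact ⟨s, r₀, C, h⟩
      have h1 := h.communicate (G := G) (recv := recv) (coin := fun r => ω (s, r)) hv hB
      rw [← exec_succ_of_not_quiet (h.not_quiet ⟨r, hr⟩)] at h1
      by_cases hlt : (if B = ∅ then C else B).card < n
      · refine ih _ hlt h1 ?_ rfl
        split_ifs with h2
        · exact ⟨r, hr⟩
        · exact Finset.nonempty_iff_ne_empty.2 h2
      · have hC' : (if B = ∅ then C else B) = C := by
          split_ifs with h2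
          · rfl
          · rw [if_neg h2] at hlt
            exact Finset.eq_of_subset_of_card_le h.senders_subset (by omega)
        rw [hC'] at h1
        refine ihj h1 fun r' => ?_
        rw [show s + 1 + j = s + (j + 1) by omega]
        exact hcoin r'

/-- A group of at least two robots at an empty node: one of them settles, the others move on. -/
theorem explore_elect (hω : Decisive ω)
    (h : Arrives port root recv ω t S v node (lead .explore e .forward)) (hS : 2 ≤ S.card)
    (hv : node v = none)
    (hp : traverse port v (nextPort (G.degree v) e) = some (w, p')) :
    ∃ r₀ ∈ S, Arrives port root recv ω (t + 1) (S.erase r₀) w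
      (Function.update node v (some (host e none false (.ready none))))
      (lead .explore (some p')
        (if e = some (nextPort (G.degree v) e) then .backward else .forward)) := by
  have hS' : S.Nonempty := Finset.card_pos.1 (by omega)
  have hv' : replyOf (node v) = none := by rw [hv]; rfl
  obtain ⟨s, hs⟩ := h.respond (R₁ := { lead .explore e .forward with control := .started })
    (O₁ := some .start) hS' rfl (by simp [lead]) fun inbox b h1 => by
      simp [Robot.step, lead, h1, hv', exploreStep]
  have key : ∀ r ∈ S, ((exec port root recv ω s).robot r).step
      (G.degree ((exec port root recv ω s).pos r))
      (recv.keep (exec port root recv ω s).round (exec port root recv ω s).subround r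
        ((exec port root recv ω s).broadcastTo r)) (ω (s, r)) =
      flip true (ω (s, r)) (lead .explore e .forward) := by
    intro r hr
    obtain ⟨r', hr', hne⟩ := Finset.exists_mem_ne (by omega : 1 < S.card) r
    have hmem : Msg.start ∈ (exec port root recv ω s).broadcastTo r :=
      Config.mem_broadcastTo.2 ⟨r', hne, by rw [hs.pos r hr, hs.pos r' hr'], hs.out r' hr'⟩
    have hne' : (recv.keep (exec port root recv ω s).round (exec port root recv ω s).subround r
        ((exec port root recv ω s).broadcastTo r)).isEmpty = false := by
      rw [List.isEmpty_eq_false_iff]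
      intro h0
      have := recv.length_keep_eq_zero.1 (List.length_eq_zero_iff.2 h0)
      rw [List.length_eq_zero_iff] at this
      simp [this] at hmem
    rw [hs.robot r hr]
    simp only [Robot.step, hne']
    rfl
  have h2 : Electing (exec port root recv ω (s + 1)) t S v node (lead .explore e .forward) S
      (S.filter fun r => ω (s, r) = true) := by
    rw [exec_succ_of_not_quiet (hs.not_quiet hS' (.inr (by simp)))]
    obtain ⟨h3, h4⟩ := hs.toLayout.communicate (G := G) (recv := recv)
      (coin := fun r => ω (s, r)) hv
    refine ⟨h3, fun r hr => ?_, fun r hr => ?_, h4, subset_rfl, Finset.filter_subset _ _⟩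
    · simp [Config.communicate, key r hr, flip, hr]
    · simp [Config.communicate, key r hr, flip, hr]
  obtain ⟨s', r₀, C', h5⟩ := h2.exists_elected hω hv hS'
  have hr₀ := h5.senders_subset (Finset.mem_singleton_self r₀)
  refine ⟨r₀, h5.candidates_subset hr₀, ?_⟩
  have h6 := h5.communicate_elected (G := G) (recv := recv) (coin := fun r => ω (s', r)) hv
  rw [← exec_succ_of_not_quiet (h5.not_quiet ⟨r₀, hr₀⟩)] at h6
  exact h6.leave rfl (by simp [foundNotElected, lead]) hp

end Election

/-! ### Ports -/

section Ports

variable {V : Type*} [Fintype V] {G : SimpleGraph V} [DecidableRel G.Adj]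
  {port : PortLabelling G} {v w : V} {p p' δ m n : ℕ} {x : Option ℕ}

theorem traverse_of_adj (port : PortLabelling G) (h : G.Adj v w) :
    traverse port v (port v ⟨w, h⟩) = some (w, (port w ⟨v, h.symm⟩ : ℕ)) := by
  have key : ∀ u : G.neighborSet v, u = ⟨w, h⟩ →
      some ((u : V), (port u ⟨v, u.2.symm⟩ : ℕ)) = some (w, (port w ⟨v, h.symm⟩ : ℕ)) := by
    rintro u rfl
    rfl
  unfold traverse
  rw [dif_pos (Fin.isLt _)]
  exact key _ (by simp)

theorem traverse_symm (h : traverse port v p = some (w, p')) :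
    traverse port w p' = some (v, p) := by
  unfold traverse at h
  split_ifs at h with hp
  simp only [Option.some.injEq, Prod.mk.injEq] at h
  obtain ⟨rfl, rfl⟩ := h
  rw [traverse_of_adj port ((port v).symm ⟨p, hp⟩).2.symm]
  exact congrArg (fun i : Fin _ => some (v, (i : ℕ))) ((port v).apply_symm_apply ⟨p, hp⟩)

theorem lt_degree_of_traverse (h : traverse port v p = some (w, p')) : p < G.degree v := by
  unfold traverse at h
  split_ifs at h with hp
  exact hp

theorem exists_traverse (port : PortLabelling G) (h : p < G.degree v) :
    ∃ w p', traverse port v p = some (w, p') := by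
  unfold traverse
  rw [dif_pos h]
  exact ⟨_, _, rfl⟩

/-- The `n`-th port of a node of degree `δ`, in cyclic order, counted from the one after the
port `x`; if `x` is empty, from port 0. -/
def turn (δ : ℕ) (x : Option ℕ) (n : ℕ) : ℕ := (x.getD (δ - 1) + n) % δ

theorem turn_lt (hδ : 0 < δ) : turn δ x n < δ := Nat.mod_lt _ hδ

theorem nextPort_turn : nextPort δ (some (turn δ x n)) = turn δ x (n + 1) := by
  simp [nextPort, turn, add_assoc]

theorem nextPort_eq_turn (hδ : 0 < δ) : nextPort δ x = turn δ x 1 := by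
  cases x with
  | none => simp [nextPort, turn, Nat.sub_add_cancel (Nat.succ_le_of_lt hδ)]
  | some p => simp [nextPort, turn]

theorem turn_inj (hm : 1 ≤ m) (hm' : m ≤ δ) (hn : 1 ≤ n) (hn' : n ≤ δ)
    (h : turn δ x m = turn δ x n) : m = n := by
  have h1 : m ≡ n [MOD δ] := Nat.ModEq.add_left_cancel' _ h
  rcases hm'.lt_or_eq with h2 | rfl <;> rcases hn'.lt_or_eq with h3 | rfl
  · exact Nat.ModEq.eq_of_lt_of_lt h1 h2 h3
  · have := h1.symm.dvd_iff (dvd_refl _)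
    simp only [dvd_refl, true_iff] at this
    have := Nat.le_of_dvd (by omega) this
    omega
  · have := h1.dvd_iff (dvd_refl _)
    simp only [dvd_refl, true_iff] at this
    have := Nat.le_of_dvd (by omega) this
    omega
  · rfl

theorem turn_self (hp : p < δ) : turn δ (some p) δ = p := by
  simp [turn, Nat.mod_eq_of_lt hp]

theorem exists_turn_eq (hp : p < δ) (x : Option ℕ) : ∃ n, 1 ≤ n ∧ n ≤ δ ∧ turn δ x n = p := by
  obtain ⟨n, hn⟩ : ∃ n : Fin δ, turn δ x (n + 1) = p := by
    have hinj : Function.Injective fun n : Fin δ =>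
        (⟨turn δ x (n + 1), turn_lt (by omega)⟩ : Fin δ) := fun a b hab => by
      have := turn_inj (by omega) (by omega) (by omega) (by omega) (Fin.mk.inj_iff.1 hab)
      exact Fin.ext (by omega)
    obtain ⟨n, hn⟩ := Finite.surjective_of_injective hinj ⟨p, hp⟩
    exact ⟨n, Fin.mk.inj_iff.1 hn⟩
  exact ⟨n + 1, by omega, by omega, hn⟩

end Ports

/-! ### The depth-first search -/

/-- The state of the depth-first search carried out by the exploring robots: the position of the
group and its variables *entered* and *direction*, the set of nodes where a robot has settled, the
ports stored there as *parent*, and, for each node, how many different ports the group has used to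
leave it, not counting the moves by which it turns round at a node visited before. -/
structure Dfs (V : Type*) where
  pos : V
  ent : Option ℕ
  dir : Direction
  settled : Finset V
  par : V → Option ℕ
  cnt : V → ℕ

theorem eq_univ_of_adj_closed {V : Type*} [Fintype V] {G : SimpleGraph V} {v : V}
    (hG : G.Connected) {s : Finset V} (hs : v ∈ s)
    (h : ∀ u ∈ s, ∀ w, G.Adj u w → w ∈ s) : s = Finset.univ := by
  refine Finset.eq_univ_iff_forall.2 fun w => ?_
  obtain ⟨W⟩ := hG.preconnected v w
  induction W with
  | nil => exact hs
  | cons hadj _ ih => exact ih (h _ hs _ hadj)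

section Dfs

variable {V : Type*} [Fintype V] {G : SimpleGraph V} [DecidableRel G.Adj]

/-- The state before the first round: all robots are at `root`, and none has settled. -/
def Dfs.initial (root : V) : Dfs V := ⟨root, none, .forward, ∅, fun _ => none, fun _ => 0⟩

/-- The node reached from `v` via port `p`, and the port through which it is entered. -/
def follow (port : PortLabelling G) (v : V) (p : ℕ) : V × Option ℕ :=
  match traverse port v p with
  | some (w, p') => (w, some p')
  | none => (v, none)

/-- The port by which the group last left the node `v`. -/
def Dfs.last (G : SimpleGraph V) [DecidableRel G.Adj] (D : Dfs V) (v : V) : ℕ :=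
  turn (G.degree v) (D.par v) (D.cnt v)

variable {port : PortLabelling G} {root v w : V} {p p' : ℕ} {D F : Dfs V} {l : List V}

/-- The list `l` leads from its first element to `root` along parent ports, and each of its elements
was reached through the port by which its successor in the list was left last. -/
def Linked (port : PortLabelling G) (root : V) (par : V → Option ℕ) (cnt : V → ℕ) :
    List V → Prop
  | [] => True
  | [v] => v = root
  | v :: u :: l => (∃ p, par v = some p ∧
      traverse port u (turn (G.degree u) (par u) (cnt u)) = some (v, p)) ∧
      Linked port root par cnt (u :: l)

theorem Linked.congr {par par' : V → Option ℕ} {cnt cnt' : V → ℕ} {v : V} {l : List V}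
    (h : Linked port root par cnt (v :: l)) (hpar : ∀ u ∈ v :: l, par' u = par u)
    (hcnt : ∀ u ∈ l, cnt' u = cnt u) : Linked port root par' cnt' (v :: l) := by
  induction l generalizing v with
  | nil => exact h
  | cons u l ih =>
    obtain ⟨⟨p, h1, h2⟩, h3⟩ := h
    refine ⟨⟨p, ?_, ?_⟩, ih h3 (fun a ha => hpar a (List.mem_cons_of_mem _ ha))
      fun a ha => hcnt a (List.mem_cons_of_mem _ ha)⟩
    · rw [hpar v (by simp), h1]
    · rw [hpar u (by simp), hcnt u (by simp), h2]

theorem Linked.root_mem {par : V → Option ℕ} {cnt : V → ℕ} {v : V} {l : List V}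
    (h : Linked port root par cnt (v :: l)) : root ∈ v :: l := by
  induction l generalizing v with
  | nil => simp [show v = root from h]
  | cons u l ih => exact List.mem_cons_of_mem _ (ih h.2)

/-- The invariant of the depth-first search. The list `l` is its stack, the top first: once
the root has been settled, it consists of the root and of the settled nodes that the group still has
to leave through their parent port. -/
structure Inv (port : PortLabelling G) (root : V) (D : Dfs V) (l : List V) : Prop where
  nodup : l.Nodup
  subset : ∀ v ∈ l, v ∈ D.settled
  linked : Linked port root D.par D.cnt l
  cnt_zero : ∀ v ∉ D.settled, D.cnt v = 0
  cnt_pos : ∀ v ∈ D.settled, 1 ≤ D.cnt v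
  cnt_le : ∀ v ∈ D.settled, D.cnt v ≤ G.degree v
  par_none : ∀ v ∈ D.settled, D.par v = none → v = root
  par_root : root ∈ D.settled → D.par root = none
  par_lt : ∀ v ∈ D.settled, ∀ p, D.par v = some p → p < G.degree v
  finished : ∀ v ∈ D.settled, v ∉ l → D.cnt v = G.degree v ∧ D.par v ≠ none
  active : ∀ v ∈ l, D.par v ≠ none → D.cnt v < G.degree v
  explored : ∀ v ∈ D.settled, ∀ n, 1 ≤ n → n ≤ D.cnt v → ∀ w p,
    traverse port v (turn (G.degree v) (D.par v) n) = some (w, p) → w ∈ D.settled ∨ w = D.pos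
  place : (l = [] ∧ D.settled = ∅ ∧ D.pos = root ∧ D.ent = none ∧ D.dir = .forward) ∨
    (∃ h l' p, l = h :: l' ∧ D.dir = .forward ∧ D.ent = some p ∧
      traverse port h (D.last G h) = some (D.pos, p)) ∨
    (∃ l', l = D.pos :: l' ∧ D.dir = .backward ∧ D.ent = some (D.last G D.pos))

theorem inv_initial (port : PortLabelling G) (root : V) : Inv port root (.initial root) [] := by
  constructor <;> simp [Dfs.initial, Linked]

theorem Inv.dir_of_notMem (h : Inv port root D l) (hpos : D.pos ∉ D.settled) :
    D.dir = .forward := by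
  rcases h.place with h1 | ⟨_, _, _, h1⟩ | ⟨l', h1, -⟩
  · exact h1.2.2.2.2
  · exact h1.2.1
  · exact absurd (h.subset _ (by simp [h1])) hpos

theorem Inv.ent_of_mem (h : Inv port root D l) (hpos : D.pos ∈ D.settled) :
    ∃ p, D.ent = some p ∧ p < G.degree D.pos := by
  rcases h.place with h1 | ⟨_, _, p, -, -, h1, h2⟩ | ⟨l', h1, -, h2⟩
  · simp [h1.2.1] at hpos
  · exact ⟨p, h1, lt_degree_of_traverse (traverse_symm h2)⟩
  · refine ⟨_, h2, turn_lt ?_⟩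
    exact (h.cnt_pos _ hpos).trans (h.cnt_le _ hpos)

theorem degree_pos_of_connected (hG : G.Connected) (hV : 2 ≤ Fintype.card V) (v : V) :
    0 < G.degree v := by
  have : Nontrivial V := Fintype.one_lt_card_iff_nontrivial.1 hV
  exact hG.preconnected.degree_pos_of_nontrivial v

/-- If the search is about to leave a node at which all ports have been used, then all nodes have
been visited. -/
theorem Inv.cnt_lt (h : Inv port root D l) (hG : G.Connected)
    (hcard : D.settled.card < Fintype.card V) (hpos : D.pos ∈ D.settled)
    (hd : D.dir = .backward) : D.cnt D.pos < G.degree D.pos := by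
  rcases h.place with h1 | ⟨_, _, _, -, h1, -⟩ | ⟨l', rfl, -, -⟩
  · simp [h1.2.1] at hpos
  · simp [hd] at h1
  by_cases hpar : D.par D.pos = none
  · refine lt_of_le_of_ne (h.cnt_le _ hpos) fun heq => ?_
    have hl' : l' = [] := by
      cases l' with
      | nil => rfl
      | cons u l =>
        obtain ⟨⟨p, h1, -⟩, -⟩ := h.linked
        simp [hpar] at h1
    subst hl'
    have : D.settled = Finset.univ := by
      refine eq_univ_of_adj_closed hG hpos fun u hu w huw => ?_
      have htr := traverse_of_adj port huw
      obtain ⟨n, hn, hn', hp⟩ := exists_turn_eq (port u ⟨w, huw⟩).isLt (D.par u)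
      rw [← hp] at htr
      have hcnt : D.cnt u = G.degree u := by
        by_cases huv : u = D.pos
        · rw [huv, heq]
        · exact (h.finished u hu (by simpa using huv)).1
      rcases h.explored u hu n hn (by omega) w _ htr with h1 | rfl
      · exact h1
      · exact hpos
    rw [this, Finset.card_univ] at hcard
    exact hcard.false
  · exact h.active _ (by simp) hpar

theorem Dfs.exists_traverse_next (port : PortLabelling G) (hδ : 0 < G.degree D.pos) :
    ∃ w p', traverse port D.pos (nextPort (G.degree D.pos) D.ent) = some (w, p') :=
  exists_traverse port (nextPort_eq_turn (x := D.ent) hδ ▸ turn_lt hδ)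

variable [DecidableEq V]

/-- One round of the depth-first search. -/
def Dfs.step (port : PortLabelling G) (D : Dfs V) : Dfs V :=
  let q := nextPort (G.degree D.pos) D.ent
  if D.pos ∉ D.settled then
    { pos := (follow port D.pos q).1
      ent := (follow port D.pos q).2
      dir := if D.ent = some q then .backward else .forward
      settled := insert D.pos D.settled
      par := Function.update D.par D.pos D.ent
      cnt := Function.update D.cnt D.pos 1 }
  else if D.dir = .forward then
    { D with
      pos := (follow port D.pos (D.ent.getD 0)).1
      ent := (follow port D.pos (D.ent.getD 0)).2
      dir := .backward }
  else
    { D with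
      pos := (follow port D.pos q).1
      ent := (follow port D.pos q).2
      dir := if D.par D.pos = some q then .backward else .forward
      cnt := Function.update D.cnt D.pos (D.cnt D.pos + 1) }

theorem Dfs.step_of_notMem (h : D.pos ∉ D.settled)
    (hp : traverse port D.pos (nextPort (G.degree D.pos) D.ent) = some (w, p')) :
    D.step port = ⟨w, some p',
      if D.ent = some (nextPort (G.degree D.pos) D.ent) then .backward else .forward,
      insert D.pos D.settled, Function.update D.par D.pos D.ent,
      Function.update D.cnt D.pos 1⟩ := by
  simp [Dfs.step, h, follow, hp]

theorem Dfs.step_of_forward (h : D.pos ∈ D.settled) (hd : D.dir = .forward)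
    (he : D.ent = some p) (hp : traverse port D.pos p = some (w, p')) :
    D.step port = ⟨w, some p', .backward, D.settled, D.par, D.cnt⟩ := by
  simp [Dfs.step, h, hd, follow, he, hp]

theorem Dfs.step_of_backward (h : D.pos ∈ D.settled) (hd : D.dir = .backward)
    (hp : traverse port D.pos (nextPort (G.degree D.pos) D.ent) = some (w, p')) :
    D.step port = ⟨w, some p',
      if D.par D.pos = some (nextPort (G.degree D.pos) D.ent) then .backward else .forward,
      D.settled, D.par, Function.update D.cnt D.pos (D.cnt D.pos + 1)⟩ := by
  simp [Dfs.step, h, hd, follow, hp]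

theorem Inv.step_notMem (h : Inv port root D l) (hδ : 0 < G.degree D.pos)
    (hpos : D.pos ∉ D.settled) : ∃ l', Inv port root (D.step port) l' := by
  obtain ⟨w, p', hp⟩ := D.exists_traverse_next port hδ
  rw [Dfs.step_of_notMem hpos hp]
  rw [nextPort_eq_turn hδ] at hp ⊢
  have hl : D.pos ∉ l := fun h1 => hpos (h.subset _ h1)
  have hent : ∀ p, D.ent = some p → p < G.degree D.pos := by
    intro p he
    rcases h.place with h1 | ⟨_, _, q, -, -, h1, h2⟩ | ⟨l', h1, -⟩
    · simp [h1.2.2.2.1] at he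
    · rw [h1] at he
      cases he
      exact lt_degree_of_traverse (traverse_symm h2)
    · exact absurd (by simp [h1]) hl
  have hlink : Linked port root (Function.update D.par D.pos D.ent)
      (Function.update D.cnt D.pos 1) (D.pos :: l) := by
    rcases h.place with ⟨rfl, h1⟩ | ⟨u, l', q, rfl, -, h1, h2⟩ | ⟨l', h1, -⟩
    · exact h1.2.1
    · have hu : ∀ a ∈ u :: l', a ≠ D.pos := fun a ha h3 => hl (h3 ▸ ha)
      refine ⟨⟨q, by simp [h1], ?_⟩, h.linked.congr (fun a ha => ?_) fun a ha => ?_⟩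
      · rw [Function.update_of_ne (hu u (by simp)), Function.update_of_ne (hu u (by simp))]
        exact h2
      · exact Function.update_of_ne (hu a ha) _ _
      · exact Function.update_of_ne (hu a (by simp [ha])) _ _
    · exact absurd (by simp [h1]) hl
  have hroot : root ∈ D.pos :: l := hlink.root_mem
  have hroot' : D.pos = root → D.ent = none := by
    rintro h3
    rcases h.place with h1 | ⟨u, l', q, rfl, -⟩ | ⟨l', h1, -⟩
    · exact h1.2.2.2.1
    · exact absurd (h3 ▸ h.linked.root_mem) hl
    · exact absurd (by simp [h1]) hl
  have hnone : D.ent = none → D.pos = root := by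
    intro h3
    rcases h.place with h1 | ⟨_, _, q, -, -, h1, h2⟩ | ⟨l', h1, -⟩
    · exact h1.2.2.1
    · simp [h1] at h3
    · exact absurd (by simp [h1]) hl
  have hne : ∀ {a}, a ∈ D.settled → a ≠ D.pos := fun ha h1 => hpos (h1 ▸ ha)
  -- a node of degree 1 is left through its parent port at once and is not put on the stack
  refine ⟨if D.ent = some (turn (G.degree D.pos) D.ent 1) then l else D.pos :: l, ?_⟩
  have hsub : ∀ a, a ∈ (if D.ent = some (turn (G.degree D.pos) D.ent 1) then l else D.pos :: l) →
      a ∈ D.pos :: l := by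
    intro a
    split_ifs
    · exact fun ha => List.mem_cons_of_mem _ ha
    · exact id
  constructor
  · split_ifs
    · exact h.nodup
    · exact List.nodup_cons.2 ⟨hl, h.nodup⟩
  · intro a ha
    rcases List.mem_cons.1 (hsub a ha) with rfl | h1
    · simp
    · exact Finset.mem_insert_of_mem (h.subset a h1)
  · split_ifs with h1
    · cases l with
      | nil => trivial
      | cons u l => exact hlink.2
    · exact hlink
  · intro a ha
    simp only [Finset.mem_insert, not_or] at ha
    simp only [Function.update_of_ne ha.1]
    exact h.cnt_zero a ha.2
  · intro a ha
    rcases Finset.mem_insert.1 ha with rfl | h1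
    · simp
    · simp only [Function.update_of_ne (hne h1)]
      exact h.cnt_pos a h1
  · intro a ha
    rcases Finset.mem_insert.1 ha with rfl | h1
    · simpa using Nat.succ_le_of_lt hδ
    · simp only [Function.update_of_ne (hne h1)]
      exact h.cnt_le a h1
  · intro a ha
    rcases Finset.mem_insert.1 ha with rfl | h1
    · simpa using hnone
    · simp only [Function.update_of_ne (hne h1)]
      exact h.par_none a h1
  · intro ha
    by_cases h1 : root = D.pos
    · simpa [h1] using hroot' h1.symm
    · simp only [Function.update_of_ne h1]
      exact h.par_root ((Finset.mem_insert.1 ha).resolve_left h1)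
  · intro a ha
    rcases Finset.mem_insert.1 ha with rfl | h1
    · simpa using hent
    · simp only [Function.update_of_ne (hne h1)]
      exact h.par_lt a h1
  · intro a ha ha'
    rcases Finset.mem_insert.1 ha with rfl | h1
    · split_ifs at ha' with h2
      · simp only [Function.update_self]
        refine ⟨?_, fun h3 => by rw [h3] at h2; cases h2⟩
        have h3 := turn_self (hent _ h2)
        rw [← h2] at h3
        exact turn_inj le_rfl hδ hδ le_rfl h3.symm
      · simp at ha'
    · simp only [Function.update_of_ne (hne h1)]
      refine h.finished a h1 fun h2 => ha' ?_
      split_ifs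
      · exact h2
      · exact List.mem_cons_of_mem _ h2
  · intro a ha
    rcases List.mem_cons.1 (hsub a ha) with rfl | h1
    · simp only [Function.update_self]
      intro h2
      obtain ⟨p, h2⟩ := Option.ne_none_iff_exists'.1 h2
      refine lt_of_le_of_ne hδ fun h3 => ?_
      have h4 : D.ent = some (turn (G.degree D.pos) D.ent 1) := by
        have := turn_self (hent _ h2)
        rw [← h2, ← h3] at this
        rw [← h3, this, h2]
      rw [if_pos h4] at ha
      exact hl ha
    · simp only [Function.update_of_ne (hne (h.subset _ h1))]
      exact h.active a h1
  · intro a ha n hn hn' w' q hq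
    rcases Finset.mem_insert.1 ha with rfl | h1
    · simp only [Function.update_self] at hn' hq
      rw [show n = 1 by omega, hp] at hq
      simp only [Option.some.injEq, Prod.mk.injEq] at hq
      exact .inr hq.1.symm
    · simp only [Function.update_of_ne (hne h1)] at hn' hq
      rcases h.explored a h1 n hn hn' w' q hq with h2 | h2
      · exact .inl (Finset.mem_insert_of_mem h2)
      · exact .inl (Finset.mem_insert.2 (.inl h2))
  · right
    split_ifs with h1
    · right
      rcases h.place with h2 | ⟨u, l', q, rfl, -, h2, h3⟩ | ⟨l', h2, -⟩
      · rw [h2.2.2.2.1] at h1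
        simp at h1
      · rw [← Option.some.inj (h2.symm.trans h1), traverse_symm h3] at hp
        simp only [Option.some.injEq, Prod.mk.injEq] at hp
        obtain ⟨rfl, rfl⟩ := hp
        have hu : u ≠ D.pos := fun h4 => hl (by simp [h4])
        refine ⟨l', rfl, rfl, ?_⟩
        simp only [Dfs.last, Function.update_of_ne hu]
      · exact absurd (by simp [h2]) hl
    · left
      refine ⟨D.pos, l, p', rfl, rfl, rfl, ?_⟩
      simpa [Dfs.last] using hp

theorem Inv.step_forward (h : Inv port root D l) (hpos : D.pos ∈ D.settled)
    (hd : D.dir = .forward) : ∃ l', Inv port root (D.step port) l' := by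
  rcases h.place with h1 | ⟨u, l', p, rfl, -, h1, h2⟩ | ⟨l', -, h1, -⟩
  · simp [h1.2.1] at hpos
  · rw [Dfs.step_of_forward hpos hd h1 (traverse_symm h2)]
    refine ⟨u :: l', { h with
      explored := fun a ha n hn hn' w q hq => .inl ?_
      place := .inr (.inr ⟨l', rfl, rfl, rfl⟩) }⟩
    rcases h.explored a ha n hn hn' w q hq with h3 | rfl
    · exact h3
    · exact hpos
  · simp [hd] at h1

theorem Inv.step_backward (h : Inv port root D l) (hG : G.Connected)
    (hcard : D.settled.card < Fintype.card V) (hpos : D.pos ∈ D.settled)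
    (hd : D.dir = .backward) : ∃ l', Inv port root (D.step port) l' := by
  have hlt := h.cnt_lt hG hcard hpos hd
  have hδ : 0 < G.degree D.pos := by omega
  obtain ⟨w, p', hp⟩ := D.exists_traverse_next port hδ
  rw [Dfs.step_of_backward hpos hd hp]
  rcases h.place with h1 | ⟨_, _, _, -, h1, -⟩ | ⟨l', rfl, -, hent⟩
  · simp [h1.2.1] at hpos
  · simp [hd] at h1
  have hq : nextPort (G.degree D.pos) D.ent =
      turn (G.degree D.pos) (D.par D.pos) (D.cnt D.pos + 1) := by
    rw [hent, Dfs.last, nextPort_turn]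
  rw [hq] at hp ⊢
  set q := turn (G.degree D.pos) (D.par D.pos) (D.cnt D.pos + 1) with hqdef
  have hl : D.pos ∉ l' := (List.nodup_cons.1 h.nodup).1
  -- the group leaves through the parent port exactly if all ports have been used then
  have hiff : ∀ p, D.par D.pos = some p → (p = q ↔ D.cnt D.pos + 1 = G.degree D.pos) := by
    intro p h1
    have h2 := turn_self (h.par_lt _ hpos p h1)
    rw [← h1] at h2
    constructor
    · rintro h3
      exact turn_inj (by omega) hlt hδ le_rfl (by rw [h2, h3])
    · intro h3
      rw [hqdef, h3, h2]
  have hlink : Linked port root D.par (Function.update D.cnt D.pos (D.cnt D.pos + 1))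
      (D.pos :: l') :=
    h.linked.congr (fun _ _ => rfl) fun a ha =>
      Function.update_of_ne (fun h1 : a = D.pos => hl (h1 ▸ ha)) _ _
  have hcnt : ∀ a, D.cnt a ≤ Function.update D.cnt D.pos (D.cnt D.pos + 1) a := by
    intro a
    by_cases ha : a = D.pos
    · subst ha; simp
    · rw [Function.update_of_ne ha]
  refine ⟨if D.par D.pos = some q then l' else D.pos :: l', ?_⟩
  have hsub : ∀ a, a ∈ (if D.par D.pos = some q then l' else D.pos :: l') → a ∈ D.pos :: l' := by
    intro a
    split_ifs
    · exact fun ha => List.mem_cons_of_mem _ ha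
    · exact id
  constructor
  · split_ifs
    · exact (List.nodup_cons.1 h.nodup).2
    · exact h.nodup
  · exact fun a ha => h.subset a (hsub a ha)
  · split_ifs with h1
    · cases l' with
      | nil => trivial
      | cons u l => exact hlink.2
    · exact hlink
  · intro a ha
    simp only [Function.update_of_ne (fun h1 => ha (h1.symm ▸ hpos) : a ≠ D.pos)]
    exact h.cnt_zero a ha
  · exact fun a ha => (h.cnt_pos a ha).trans (hcnt a)
  · intro a ha
    by_cases h1 : a = D.pos
    · subst h1; simpa using hlt
    · simp only [Function.update_of_ne h1]
      exact h.cnt_le a ha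
  · exact h.par_none
  · exact h.par_root
  · exact h.par_lt
  · intro a ha ha'
    by_cases h1 : a = D.pos
    · subst h1
      split_ifs at ha' with h2
      · simp [(hiff _ h2).1 rfl, h2]
      · simp at ha'
    · simp only [Function.update_of_ne h1]
      refine h.finished a ha fun h2 => ha' ?_
      have h3 := (List.mem_cons.1 h2).resolve_left h1
      split_ifs
      · exact h3
      · exact h2
  · intro a ha hpar
    by_cases h1 : a = D.pos
    · subst h1
      obtain ⟨p, h2⟩ := Option.ne_none_iff_exists'.1 hpar
      simp only [Function.update_self]
      refine lt_of_le_of_ne hlt fun h3 => ?_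
      rw [if_pos (by rw [h2, (hiff p h2).2 h3])] at ha
      exact hl ha
    · simp only [Function.update_of_ne h1]
      exact h.active a (hsub a ha) hpar
  · intro a ha n hn hn' w' q' hq'
    by_cases h1 : a = D.pos ∧ n = D.cnt D.pos + 1
    · obtain ⟨rfl, rfl⟩ := h1
      rw [← hqdef, hp] at hq'
      simp only [Option.some.injEq, Prod.mk.injEq] at hq'
      exact .inr hq'.1.symm
    · left
      have hn'' : n ≤ D.cnt a := by
        by_cases h2 : a = D.pos
        · subst h2
          simp only [Function.update_self] at hn'
          have : n ≠ D.cnt D.pos + 1 := fun h3 => h1 ⟨rfl, h3⟩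
          omega
        · simpa only [Function.update_of_ne h2] using hn'
      rcases h.explored a ha n hn hn'' w' q' hq' with h3 | rfl
      · exact h3
      · exact hpos
  · right
    split_ifs with h1
    · right
      cases l' with
      | nil =>
        have h2 : D.pos = root := h.linked
        rw [h2, h.par_root (h2 ▸ hpos)] at h1
        simp at h1
      | cons u l =>
        obtain ⟨⟨p, h2, h3⟩, -⟩ := h.linked
        rw [← Option.some.inj (h2.symm.trans h1), traverse_symm h3] at hp
        simp only [Option.some.injEq, Prod.mk.injEq] at hp
        obtain ⟨rfl, rfl⟩ := hp
        refine ⟨l, rfl, rfl, ?_⟩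
        have hu : u ≠ D.pos := fun h4 => hl (by simp [h4])
        simp only [Dfs.last, Function.update_of_ne hu]
    · left
      refine ⟨D.pos, l', p', rfl, rfl, rfl, ?_⟩
      simpa [Dfs.last] using hp

theorem Inv.exists_step (h : Inv port root D l) (hG : G.Connected) (hV : 2 ≤ Fintype.card V)
    (hcard : D.settled.card < Fintype.card V) : ∃ l', Inv port root (D.step port) l' := by
  by_cases hpos : D.pos ∈ D.settled
  · cases hd : D.dir with
    | forward => exact h.step_forward hpos hd
    | backward => exact h.step_backward hG hcard hpos hd
  · exact h.step_notMem (degree_pos_of_connected hG hV _) hpos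

theorem Dfs.settled_step (D : Dfs V) : (D.step port).settled =
    if D.pos ∉ D.settled then insert D.pos D.settled else D.settled := by
  unfold Dfs.step
  dsimp only
  rw [apply_ite Dfs.settled, apply_ite Dfs.settled, ite_self]

theorem Dfs.par_step (D : Dfs V) : (D.step port).par =
    if D.pos ∉ D.settled then Function.update D.par D.pos D.ent else D.par := by
  unfold Dfs.step
  dsimp only
  rw [apply_ite Dfs.par, apply_ite Dfs.par, ite_self]

theorem Dfs.cnt_step (D : Dfs V) : (D.step port).cnt =
    if D.pos ∉ D.settled then Function.update D.cnt D.pos 1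
    else if D.dir = .forward then D.cnt
    else Function.update D.cnt D.pos (D.cnt D.pos + 1) := by
  unfold Dfs.step
  dsimp only
  rw [apply_ite Dfs.cnt, apply_ite Dfs.cnt]

theorem Dfs.settled_subset_step (D : Dfs V) : D.settled ⊆ (D.step port).settled := by
  rw [Dfs.settled_step]
  split_ifs with h
  · exact subset_rfl
  · exact Finset.subset_insert _ _

theorem Inv.cnt_le_step (h : Inv port root D l) (v : V) : D.cnt v ≤ (D.step port).cnt v := by
  rw [Dfs.cnt_step]
  by_cases hv : v = D.pos
  · subst hv
    split_ifs with h1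
    · exact le_rfl
    · simp
    · simp [h.cnt_zero _ h1]
  · split_ifs <;> simp [Function.update_of_ne hv]

theorem Dfs.par_step_of_mem (hv : v ∈ D.settled) : (D.step port).par v = D.par v := by
  rw [Dfs.par_step]
  split_ifs with h1
  · rfl
  · exact Function.update_of_ne (fun h2 : v = D.pos => h1 (h2 ▸ hv)) _ _

/-- A quantity that increases in each round of the depth-first search. -/
def Dfs.potential (D : Dfs V) : ℕ := 2 * ∑ v, D.cnt v + if D.dir = .backward then 1 else 0

theorem Inv.potential_lt_step (h : Inv port root D l) :
    D.potential < (D.step port).potential := by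
  have hsum : ∀ n, D.cnt D.pos < n → ∑ v, D.cnt v < ∑ v, Function.update D.cnt D.pos n v := by
    intro n hn
    refine Finset.sum_lt_sum (fun a _ => ?_) ⟨D.pos, Finset.mem_univ _, by simpa using hn⟩
    by_cases ha : a = D.pos
    · subst ha; simpa using hn.le
    · rw [Function.update_of_ne ha]
  by_cases hpos : D.pos ∈ D.settled
  · cases hd : D.dir with
    | forward => simp [Dfs.step, Dfs.potential, hpos, hd]
    | backward =>
      have := hsum _ (Nat.lt_succ_self _)
      simp only [Dfs.step, Dfs.potential, hpos, hd]
      simp only [not_true_eq_false, reduceCtorEq, if_true, if_false, Nat.succ_eq_add_one] at this ⊢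
      omega
  · have hd := h.dir_of_notMem hpos
    have := hsum 1 (by simp [h.cnt_zero _ hpos])
    simp only [Dfs.step, Dfs.potential, hpos, hd]
    simp only [not_false_eq_true, reduceCtorEq, if_true, if_false]
    omega

theorem Inv.potential_le (h : Inv port root D l) :
    D.potential ≤ 2 * ∑ v, G.degree v + 1 := by
  have : ∑ v, D.cnt v ≤ ∑ v, G.degree v := Finset.sum_le_sum fun v _ => by
    by_cases hv : v ∈ D.settled
    · exact h.cnt_le v hv
    · simp [h.cnt_zero v hv]
  unfold Dfs.potential
  split_ifs <;> omega

end Dfs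

section Search

variable {V : Type*} [Fintype V] [DecidableEq V] {G : SimpleGraph V} [DecidableRel G.Adj]
  {port : PortLabelling G} {root : V} {k i j T : ℕ}

/-- The state of the depth-first search after `i` rounds. -/
def dfs (port : PortLabelling G) (root : V) (i : ℕ) : Dfs V := (Dfs.step port)^[i] (.initial root)

theorem dfs_succ (port : PortLabelling G) (root : V) (i : ℕ) :
    dfs port root (i + 1) = (dfs port root i).step port :=
  Function.iterate_succ_apply' _ _ _

/-- All but one of `k` robots have settled, and the last one is at an empty node. -/
def Dfs.Stopped (k : ℕ) (D : Dfs V) : Prop := D.settled.card + 1 = k ∧ D.pos ∉ D.settled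

theorem exists_inv_dfs (hG : G.Connected) (hk : 2 ≤ k) (hkn : k ≤ Fintype.card V)
    (h : ∀ j < i, ¬ (dfs port root j).Stopped k) :
    (∃ l, Inv port root (dfs port root i) l) ∧ (dfs port root i).settled.card + 1 ≤ k := by
  induction i with
  | zero => exact ⟨⟨[], inv_initial port root⟩, by simp [dfs, Dfs.initial]; omega⟩
  | succ i ih =>
    obtain ⟨⟨l, hl⟩, hcard⟩ := ih fun j hj => h j (by omega)
    rw [dfs_succ]
    refine ⟨hl.exists_step hG (by omega) (by omega), ?_⟩
    have hi : _ ∨ _ := not_and_or.1 (h i (by omega))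
    rw [Dfs.settled_step]
    split_ifs with hpos
    · exact hcard
    · rw [Finset.card_insert_of_notMem hpos]
      have := hi.resolve_right (not_not.2 hpos)
      omega

/-- The depth-first search reaches an empty node when only one robot is left: otherwise its
potential would increase for ever. -/
theorem exists_stopped (hG : G.Connected) (hk : 2 ≤ k) (hkn : k ≤ Fintype.card V)
    (port : PortLabelling G) (root : V) : ∃ i, (dfs port root i).Stopped k := by
  by_contra! hcon
  have hpot : ∀ i, i ≤ (dfs port root i).potential := fun i => by
    induction i with
    | zero => exact Nat.zero_le _
    | succ i ih =>
      obtain ⟨⟨l, hl⟩, -⟩ := exists_inv_dfs (i := i) hG hk hkn fun j _ => hcon j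
      have := hl.potential_lt_step
      rw [dfs_succ]
      omega
  obtain ⟨⟨l, hl⟩, -⟩ := exists_inv_dfs hG hk hkn
    fun j (_ : j < 2 * ∑ v, G.degree v + 2) => hcon j
  have := hl.potential_le
  have := hpot (2 * ∑ v, G.degree v + 2)
  omega

/-- `F` is a later state of the depth-first search than `D`. -/
structure Dfs.Before (D F : Dfs V) : Prop where
  settled : D.settled ⊆ F.settled
  cnt : ∀ v, D.cnt v ≤ F.cnt v
  par : ∀ v ∈ D.settled, F.par v = D.par v

theorem dfs_before (hG : G.Connected) (hk : 2 ≤ k) (hkn : k ≤ Fintype.card V)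
    (h : ∀ j < T, ¬ (dfs port root j).Stopped k) (hij : i ≤ j) (hj : j ≤ T) :
    (dfs port root i).Before (dfs port root j) := by
  induction j, hij using Nat.le_induction with
  | base => exact ⟨subset_rfl, fun _ => le_rfl, fun _ _ => rfl⟩
  | succ j hij ih =>
    have ih := ih (by omega)
    obtain ⟨⟨l, hl⟩, -⟩ := exists_inv_dfs (i := j) hG hk hkn fun j' _ => h j' (by omega)
    rw [dfs_succ]
    exact ⟨ih.settled.trans (Dfs.settled_subset_step _),
      fun v => (ih.cnt v).trans (hl.cnt_le_step v),
      fun v hv => (Dfs.par_step_of_mem (ih.settled hv)).trans (ih.par v hv)⟩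

end Search

section Simulation

variable {V : Type*} {k : ℕ} [Fintype V] [DecidableEq V] {G : SimpleGraph V} [DecidableRel G.Adj]
  {port : PortLabelling G} {root : V} {recv : Reception k} {ω : ℕ × Fin k → Bool}
  {t i T : ℕ} {S : Finset (Fin k)} {D F : Dfs V} {l l' : List V} {v : V}

/-! ### The exploration -/

/-- The memories of the settled robots during the exploration. -/
def exploreNode (D : Dfs V) (v : V) : Option Robot :=
  if v ∈ D.settled then some (host (D.par v) none false (.ready none)) else none

theorem explore_round (hω : Decisive ω) (hG : G.Connected) (hV : 2 ≤ Fintype.card V)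
    (h : Inv port root D l)
    (harr : Arrives port root recv ω t S D.pos (exploreNode D) (lead .explore D.ent D.dir))
    (hcard : S.card + D.settled.card = k) (hS : S.Nonempty)
    (hgo : D.pos ∈ D.settled ∨ 2 ≤ S.card) :
    ∃ S' ⊆ S, Arrives port root recv ω (t + 1) S' (D.step port).pos (exploreNode (D.step port))
      (lead .explore (D.step port).ent (D.step port).dir) ∧
      S'.card + (D.step port).settled.card = k := by
  have hδ := degree_pos_of_connected hG hV D.pos
  by_cases hpos : D.pos ∈ D.settled
  · have hv : replyOf (exploreNode D D.pos) = some (D.par D.pos, none, false) := by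
      simp [exploreNode, hpos, replyOf, host]
    cases hd : D.dir with
    | forward =>
      obtain ⟨p, he, hp⟩ := h.ent_of_mem hpos
      obtain ⟨w, p', hp⟩ := exists_traverse port hp
      rw [Dfs.step_of_forward hpos hd he hp]
      rw [he, hd] at harr
      exact ⟨S, subset_rfl, explore_forward harr hS hv hp, hcard⟩
    | backward =>
      obtain ⟨w, p', hp⟩ := D.exists_traverse_next port hδ
      rw [Dfs.step_of_backward hpos hd hp]
      rw [hd] at harr
      exact ⟨S, subset_rfl, explore_backward harr hS hv hp, hcard⟩
  · obtain ⟨w, p', hp⟩ := D.exists_traverse_next port hδ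
    rw [Dfs.step_of_notMem hpos hp]
    rw [h.dir_of_notMem hpos] at harr
    obtain ⟨r₀, hr₀, h1⟩ := explore_elect hω harr (hgo.resolve_left hpos)
      (by simp [exploreNode, hpos]) hp
    refine ⟨S.erase r₀, Finset.erase_subset _ _, ?_, ?_⟩
    · convert h1 using 1
      funext v
      by_cases hv : v = D.pos
      · subst hv; simp [exploreNode]
      · simp [exploreNode, hv]
    · have := Finset.card_pos.2 ⟨r₀, hr₀⟩
      rw [Finset.card_erase_of_mem hr₀, Finset.card_insert_of_notMem hpos]
      omega

/-- At the beginning of round `i + 1` the group `S` carries out step `i + 1` of the depth-first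
search. -/
def Exploring (port : PortLabelling G) (root : V) (recv : Reception k) (ω : ℕ × Fin k → Bool)
    (i : ℕ) (S : Finset (Fin k)) : Prop :=
  Arrives port root recv ω (i + 1) S (dfs port root i).pos (exploreNode (dfs port root i))
    (lead .explore (dfs port root i).ent (dfs port root i).dir) ∧
    S.card + (dfs port root i).settled.card = k

theorem exists_exploring (hω : Decisive ω) (hG : G.Connected) (hk : 2 ≤ k)
    (hkn : k ≤ Fintype.card V) (h : ∀ j < T, ¬ (dfs port root j).Stopped k) (hi : i ≤ T) :
    ∃ S, Exploring port root recv ω i S ∧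
      ∀ j < i, ∃ S', S ⊆ S' ∧ Exploring port root recv ω j S' := by
  induction i with
  | zero =>
    refine ⟨Finset.univ, ⟨⟨0, rfl, ?_⟩, by simp [dfs, Dfs.initial]⟩, by simp⟩
    constructor
    · constructor <;> simp [exec, Config.initial, dfs, Dfs.initial, exploreNode]
    all_goals simp [exec, Config.initial, dfs, Dfs.initial, Robot.initial, lead]
  | succ i ih =>
    obtain ⟨S, ⟨h1, h2⟩, h3⟩ := ih (by omega)
    obtain ⟨⟨l, hl⟩, hcard⟩ := exists_inv_dfs (i := i) hG hk hkn fun j _ => h j (by omega)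
    have hgoing := h i (by omega)
    have hgo : (dfs port root i).pos ∈ (dfs port root i).settled ∨ 2 ≤ S.card := by
      by_contra! hcon
      exact hgoing ⟨by omega, hcon.1⟩
    obtain ⟨S', hS', h4, h5⟩ := explore_round hω hG (by omega) hl h1 h2
      (Finset.card_pos.1 (by omega)) hgo
    rw [← dfs_succ] at h4 h5
    refine ⟨S', ⟨h4, h5⟩, fun j hj => ?_⟩
    rcases Nat.lt_succ_iff_lt_or_eq.1 hj with hj | rfl
    · obtain ⟨S'', h6, h7⟩ := h3 j hj
      exact ⟨S'', hS'.trans h6, h7⟩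
    · exact ⟨S, hS', h1, h2⟩

/-! ### The way back to the root -/

/-- The memories of the settled robots when the returning robot has visited the nodes in `l`. -/
def returnNode (G : SimpleGraph V) [DecidableRel G.Adj] (F : Dfs V) (l : List V) (v : V) :
    Option Robot :=
  if v ∈ F.settled then
    some (host (F.par v) (if v ∈ l then some (F.last G v) else none) false (.ready none))
  else none

omit [DecidableEq V] in
theorem Linked.of_append {par : V → Option ℕ} {cnt : V → ℕ}
    (h : Linked port root par cnt (l' ++ l)) : Linked port root par cnt l := by
  induction l' with
  | nil => exact h
  | cons v l' ih =>
    cases hl : l' ++ l with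
    | nil =>
      rw [(List.append_eq_nil_iff.1 hl).2]
      trivial
    | cons u l₁ =>
      refine ih ?_
      rw [List.cons_append, hl] at h
      rw [hl]
      exact h.2

/-- The returning robot walks down the stack and stores as *child*, at each node, the port by which
the node was left last. -/
theorem return_rounds (h : Inv port root F (v :: l)) (hS : S.Nonempty)
    (harr : Arrives port root recv ω t S v (exploreNode F)
      (lead .ret (some (F.last G v)) .forward)) {l₁ l₂ : List V} {u : V}
    (hl : v :: l = l₁ ++ u :: l₂) :
    Arrives port root recv ω (t + l₁.length) S u (returnNode G F l₁)
      (lead .ret (some (F.last G u)) .forward) := by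
  induction l₁ using List.reverseRecOn generalizing u l₂ with
  | nil =>
    obtain ⟨rfl, rfl⟩ := List.cons_eq_cons.1 hl
    have h1 : returnNode G F [] = exploreNode F := by
      funext v
      simp [returnNode, exploreNode]
    rw [h1]
    exact harr
  | append_singleton l₁ a ih =>
    rw [List.append_assoc, List.singleton_append] at hl
    have h1 := ih hl
    have hlink := h.linked
    rw [hl] at hlink
    obtain ⟨⟨p, h2, h3⟩, -⟩ := hlink.of_append
    have hnd := h.nodup
    rw [hl] at hnd
    have ha : a ∉ l₁ := fun h4 => (List.nodup_append.1 hnd).2.2 a h4 a (by simp) rfl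
    have has : a ∈ F.settled := h.subset a (by simp [hl])
    have h5 := return_step h1 hS (by simp [returnNode, has, h2, ha]) (traverse_symm h3)
    rw [← Dfs.last] at h5
    rw [List.length_append, List.length_singleton, ← add_assoc]
    convert h5 using 1
    funext b
    by_cases hb : b = a
    · subst hb; simp [returnNode, has, h2]
    · simp [returnNode, hb]

/-! ### The second traversal -/

/-- The memories of the settled robots when the acknowledging robot has repeated the depth-first
search, with final state `F` and stack `l`, up to the state `D`: a robot terminates when its node
is left for the last time. -/
def repeatNode (G : SimpleGraph V) [DecidableRel G.Adj] (D F : Dfs V) (l : List V) (v : V) :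
    Option Robot :=
  if v ∈ F.settled then
    some (host (F.par v) (if v ∈ l then some (F.last G v) else none) (decide (v ∈ D.settled))
      (if D.cnt v = F.cnt v then .terminated else .ready none))
  else none

/-- The conditions under which the robot settled at `v` is instructed to terminate hold just when
`v` is left for the last time. -/
theorem Inv.last_departure_iff (h : Inv port root F l) (hv : v ∈ F.settled) {n : ℕ} (hn : 1 ≤ n)
    (hn' : n ≤ F.cnt v) :
    (F.par v = some (turn (G.degree v) (F.par v) n) ∨
      (if v ∈ l then some (F.last G v) else none) = some (turn (G.degree v) (F.par v) n)) ↔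
      n = F.cnt v := by
  have hle := h.cnt_le v hv
  constructor
  · rintro (h1 | h1)
    · have h2 := turn_self (h.par_lt v hv _ h1)
      rw [← h1] at h2
      have := turn_inj (by omega) le_rfl hn (by omega) h2
      omega
    · split_ifs at h1 with h2
      exact turn_inj hn (by omega) (by omega) hle (Option.some.inj h1).symm
  · rintro rfl
    by_cases hl : v ∈ l
    · right; simp [hl, Dfs.last]
    · left
      obtain ⟨h1, h2⟩ := h.finished v hv hl
      obtain ⟨p, h2⟩ := Option.ne_none_iff_exists'.1 h2
      have h3 := turn_self (h.par_lt v hv p h2)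
      rw [← h2] at h3
      rw [h1, h3, h2]

/-- The acknowledging robot repeats a round of the depth-first search. -/
theorem repeat_round (hG : G.Connected) (hV : 2 ≤ Fintype.card V) (h : Inv port root D l')
    (hF : Inv port root F l) (hDF : (D.step port).Before F) (hS : S.Nonempty)
    (harr : Arrives port root recv ω t S D.pos (repeatNode G D F l)
      (lead .acknowledge D.ent D.dir)) :
    Arrives port root recv ω (t + 1) S (D.step port).pos (repeatNode G (D.step port) F l)
      (lead .acknowledge (D.step port).ent (D.step port).dir) := by
  have hδ := degree_pos_of_connected hG hV D.pos
  obtain ⟨hsub, hcnt, hpar⟩ := hDF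
  by_cases hpos : D.pos ∈ D.settled
  · have hFpos : D.pos ∈ F.settled := hsub (D.settled_subset_step hpos)
    cases hd : D.dir with
    | forward =>
      obtain ⟨p, he, hp⟩ := h.ent_of_mem hpos
      obtain ⟨w, p', hp⟩ := exists_traverse port hp
      rw [Dfs.step_of_forward hpos hd he hp]
      rw [he, hd] at harr
      refine acknowledge_forward harr hS ?_ hp
      by_cases hc : D.cnt D.pos = F.cnt D.pos
      · left; simp [repeatNode, hFpos, hc, replyOf, host]
      · right; simp [repeatNode, hFpos, hc, replyOf, host, hpos]
    | backward =>
      obtain ⟨w, p', hp⟩ := D.exists_traverse_next port hδ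
      have hent : D.ent = some (D.last G D.pos) := by
        rcases h.place with h1 | ⟨_, _, _, -, h1, -⟩ | ⟨l', -, -, h1⟩
        · simp [h1.2.1] at hpos
        · simp [hd] at h1
        · exact h1
      rw [Dfs.step_of_backward hpos hd hp] at hsub hcnt hpar ⊢
      rw [hd] at harr
      have hparpos : F.par D.pos = D.par D.pos := hpar _ hpos
      have hlt : D.cnt D.pos + 1 ≤ F.cnt D.pos := by simpa using hcnt D.pos
      have hq : nextPort (G.degree D.pos) D.ent =
          turn (G.degree D.pos) (F.par D.pos) (D.cnt D.pos + 1) := by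
        rw [hent, Dfs.last, nextPort_turn, hparpos]
      have h1 := acknowledge_backward harr hS (x := F.par D.pos)
        (y := if D.pos ∈ l then some (F.last G D.pos) else none) (by
          have hc : D.cnt D.pos ≠ F.cnt D.pos := by omega
          simp [repeatNode, hFpos, hc, hpos]) hp
      rw [hparpos] at h1
      convert h1 using 1
      funext v
      by_cases hv : v = D.pos
      · subst hv
        have h2 := hF.last_departure_iff hFpos (Nat.le_add_left 1 _) hlt
        rw [← hq, hparpos] at h2
        rw [Function.update_self]
        simp only [h2]
        simp [repeatNode, hFpos, hparpos, hpos]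
      · simp [repeatNode, hv]
  · obtain ⟨w, p', hp⟩ := D.exists_traverse_next port hδ
    rw [Dfs.step_of_notMem hpos hp] at hsub hcnt hpar ⊢
    rw [h.dir_of_notMem hpos] at harr
    have hFpos : D.pos ∈ F.settled := hsub (by simp)
    have hparpos : F.par D.pos = D.ent := by simpa using hpar D.pos (by simp)
    have hle : 1 ≤ F.cnt D.pos := hF.cnt_pos _ hFpos
    have h1 := acknowledge_first harr hS (x := F.par D.pos)
      (y := if D.pos ∈ l then some (F.last G D.pos) else none) (by
        have hc : D.cnt D.pos ≠ F.cnt D.pos := by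
          rw [h.cnt_zero _ hpos]
          omega
        simp [repeatNode, hFpos, hc, hpos]) hp
    convert h1 using 1
    funext v
    by_cases hv : v = D.pos
    · subst hv
      have h2 := hF.last_departure_iff hFpos le_rfl hle
      rw [hparpos, ← nextPort_eq_turn hδ] at h2
      rw [Function.update_self]
      simp only [h2]
      simp [repeatNode, hFpos, hparpos]
    · simp [repeatNode, hv]

/-! ### Reading off the stages -/

/-- Rounds and subrounds increase lexicographically; in particular, each round begins only once. -/
theorem exec_lex (h : i < t) :
    (exec port root recv ω i).round < (exec port root recv ω t).round ∨
      (exec port root recv ω i).round = (exec port root recv ω t).round ∧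
      (exec port root recv ω i).subround < (exec port root recv ω t).subround := by
  have hstep : ∀ s, (exec port root recv ω s).round < (exec port root recv ω (s + 1)).round ∨
      (exec port root recv ω s).round = (exec port root recv ω (s + 1)).round ∧
      (exec port root recv ω s).subround < (exec port root recv ω (s + 1)).subround := by
    intro s
    by_cases hq : (exec port root recv ω s).Quiet
    · rw [exec_succ_of_quiet hq]
      simp [Config.advance]
    · rw [exec_succ_of_not_quiet hq]
      simp [Config.communicate]
  induction t, h using Nat.le_induction with
  | base => exact hstep i
  | succ t ht ih =>
    have := hstep t
    omega

theorem Arrives.of_atBeginning {node : V → Option Robot} {R : Robot} {A : Config V k → Prop}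
    (h : Arrives port root recv ω t S v node R) (hA : AtBeginning port root recv ω t A) :
    ∃ c : Config V k, Mid c t S v node R none none ∧ A c := by
  obtain ⟨s, hs, hm⟩ := h
  obtain ⟨s', h1, h2, h3⟩ := hA
  have : s = s' := by
    rcases lt_trichotomy s s' with hlt | rfl | hlt
    · have := exec_lex (port := port) (root := root) (recv := recv) (ω := ω) hlt
      have := hm.round
      omega
    · rfl
    · have := exec_lex (port := port) (root := root) (recv := recv) (ω := ω) hlt
      have := hm.round
      omega
  subst this
  exact ⟨_, hm, h3⟩

theorem AtBeginning.one_le {A : Config V k → Prop} (hA : AtBeginning port root recv ω t A) :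
    1 ≤ t := by
  obtain ⟨s, rfl, -, -⟩ := hA
  rcases Nat.eq_zero_or_pos s with rfl | hs
  · exact le_rfl
  · have := exec_lex (port := port) (root := root) (recv := recv) (ω := ω) hs
    have : (exec port root recv ω 0).round = 1 := rfl
    omega

omit [Fintype V] in
theorem Mid.dispersed {c : Config V k} {r : Fin k} {node : V → Option Robot} {R : Robot}
    {O O' : Option Msg} (h : Mid c t {r} v node R O O') (hv : node v = none) : c.Dispersed := by
  have hr := h.pos r (by simp)
  have hne : ∀ r', r' ≠ r → c.pos r' ≠ v := fun r' h1 h2 => by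
    have := h.node_pos r' (by simpa using h1)
    simp [h2, hv] at this
  intro a b hab
  by_cases ha : a = r <;> by_cases hb : b = r
  · rw [ha, hb]
  · subst ha; exact absurd (hab.symm.trans hr) (hne b hb)
  · subst hb; exact absurd (hab.trans hr) (hne a ha)
  · exact h.inj a (by simpa using ha) b (by simpa using hb) hab

/-- Once all robots have terminated, rounds without any action follow each other for ever. -/
theorem Arrives.fromEndOf {r : Fin k} {node : V → Option Robot} {R : Robot}
    (h : Arrives port root recv ω (t + 1) {r} v node R) (hR : R.control = .terminated)
    (hv : node v = none) (hn : ∀ u m, node u = some m → m.control = .terminated) :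
    FromEndOf port root recv ω t fun c => c.Dispersed ∧ c.AllTerminated := by
  obtain ⟨s, hs, hm⟩ := h
  refine ⟨s, hm.round, hs, fun s' hs' => ?_⟩
  obtain ⟨t', hm'⟩ : ∃ t', Mid (exec port root recv ω s') t' {r} v node R none none := by
    clear hs
    induction s', hs' using Nat.le_induction with
    | base => exact ⟨_, hm⟩
    | succ s' _ ih =>
      obtain ⟨t', ih⟩ := ih
      refine ⟨t' + 1, ?_⟩
      rw [exec_succ_of_quiet (ih.quiet (by simp [hR, Control.finished]))]
      have := ih.advance port
      simp only [moveOf, hR, Robot.nextControl, if_true] at this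
      rwa [← hR] at this
  refine ⟨hm'.dispersed hv, fun r' => ?_⟩
  by_cases hr' : r' = r
  · rw [hm'.robot r' (by simp [hr']), hR]
  · exact hn _ _ (hm'.node_pos r' (by simpa using hr'))

end Simulation

/-! ### Almost all coin flips are decisive -/

open MeasureTheory ProbabilityTheory in
theorem ae_decisive (k : ℕ) : ∀ᵐ ω ∂(coinMeasure k), Decisive ω := by
  unfold Decisive
  rw [ae_all_iff]
  intro r
  set A : ℕ → Set (ℕ × Fin k → Bool) := fun s => {ω | ∀ r', ω (s, r') = decide (r' = r)} with hA
  have hmeas : ∀ F : Finset ℕ, coinMeasure k (⋂ s ∈ F, A s) = ∏ s ∈ F, (2⁻¹ : ENNReal) ^ k := by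
    intro F
    have hbox : (⋂ s ∈ F, A s) =
        Set.pi (F ×ˢ (Finset.univ : Finset (Fin k)) : Finset (ℕ × Fin k))
          fun i => {decide (i.2 = r)} := by
      ext ω
      simp only [hA, Set.mem_iInter, Set.mem_ofPred_eq, Set.mem_pi, Finset.mem_coe,
        Finset.mem_product, Finset.mem_univ, and_true, Set.mem_singleton_iff, Prod.forall]
      exact ⟨fun h s r' hs => h s hs r', fun h s hs r' => h s r' hs⟩
    rw [hbox, coinMeasure, Measure.infinitePi_pi _ fun _ _ => MeasurableSet.singleton _,
      Finset.prod_product]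
    refine Finset.prod_congr rfl fun s _ => ?_
    rw [Finset.prod_congr rfl (g := fun _ => (2⁻¹ : ENNReal)) fun r' _ => by
      rw [PMF.toMeasure_apply_singleton _ _ (MeasurableSet.singleton _)]
      simp]
    simp
  have hone : ∀ s, coinMeasure k (A s) = (2⁻¹ : ENNReal) ^ k := fun s => by
    simpa using hmeas {s}
  have hAm : ∀ s, MeasurableSet (A s) := fun s => by
    have : A s = ⋂ r', (fun ω : ℕ × Fin k → Bool => ω (s, r')) ⁻¹' {decide (r' = r)} := by
      ext ω; simp [hA]
    rw [this]
    exact MeasurableSet.iInter fun r' => measurable_pi_apply _ (MeasurableSet.singleton _)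
  have : IsProbabilityMeasure (coinMeasure k) := by unfold coinMeasure; infer_instance
  have hind : iIndepSet A (coinMeasure k) :=
    (iIndepSet_iff_meas_biInter hAm).2 fun F => by
      rw [hmeas F]
      exact Finset.prod_congr rfl fun s _ => (hone s).symm
  have hlim := measure_limsup_eq_one hAm hind (by
    simp only [hone]
    exact ENNReal.tsum_const_eq_top_of_ne_zero (by simp))
  have hae : ∀ᵐ ω ∂(coinMeasure k), ω ∈ Filter.limsup A Filter.atTop :=
    (prob_compl_eq_zero_iff (MeasurableSet.measurableSet_limsup hAm)).2 hlim
  filter_upwards [hae] with ω hω s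
  rw [Filter.mem_limsup_iff_frequently_mem, Filter.frequently_atTop] at hω
  exact hω s

/-! ### The stages of the execution -/

section Stages

variable {V : Type*} {k : ℕ} [Fintype V] [DecidableEq V] {G : SimpleGraph V} [DecidableRel G.Adj]
  {port : PortLabelling G} {root : V} {recv : Reception k} {ω : ℕ × Fin k → Bool}
  {t T : ℕ} {F : Dfs V} {l : List V} {v : V} {rL : Fin k}

/-- Before the depth-first search is over, the first stage is not over: two robots are exploring,
or the exploring robot is at the node of a settled one. -/
theorem Exploring.not_firstStageOver {i : ℕ} {S : Finset (Fin k)}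
    (h : Exploring port root recv ω i S) (hr : rL ∈ S)
    (hi : ¬ (dfs port root i).Stopped k) :
    ¬ AtBeginning port root recv ω (i + 1) fun c => c.FirstStageOver rL := by
  intro hA
  obtain ⟨c, hm, hdis, -, hset⟩ := h.1.of_atBeginning hA
  have hS : S = {rL} := by
    refine Finset.eq_singleton_iff_unique_mem.2 ⟨hr, fun r hr' => ?_⟩
    by_contra hne
    have := hset r hne
    rw [hm.robot r hr'] at this
    simp [lead] at this
  have hpos : (dfs port root i).pos ∈ (dfs port root i).settled := by
    by_contra hpos
    refine hi ⟨?_, hpos⟩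
    have := h.2
    rw [hS, Finset.card_singleton] at this
    omega
  obtain ⟨r, hr', h1⟩ := hm.surj (dfs port root i).pos (by simp [exploreNode, hpos])
  exact hr' (hdis (h1.trans (hm.pos rL hr).symm) ▸ hr)

theorem isLeast_firstStageOver (hT : (dfs port root T).Stopped k)
    (hmin : ∀ j < T, ¬ (dfs port root j).Stopped k)
    (hrL : Exploring port root recv ω T {rL})
    (hS : ∀ j < T, ∃ S, {rL} ⊆ S ∧ Exploring port root recv ω j S) :
    IsLeast {t | AtBeginning port root recv ω t fun c => c.FirstStageOver rL} (T + 1) := by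
  constructor
  · obtain ⟨s, hs, hm⟩ := hrL.1
    refine ⟨s, hm.round, hs, hm.dispersed (by simp [exploreNode, hT.2]), ?_, fun r hr => ?_⟩
    · rw [hm.robot rL (by simp)]
      rfl
    · exact (hm.settled _ _ (hm.node_pos r (by simpa using hr))).role
  · intro t ht
    obtain ⟨i, rfl⟩ := Nat.exists_eq_add_of_le' ht.one_le
    by_contra! hlt
    have hi : i < T := by omega
    obtain ⟨S, hS, hex⟩ := hS i hi
    exact hex.not_firstStageOver (hS (by simp)) (hmin i hi) ht

theorem Exploring.not_backAtRoot {i : ℕ} {S : Finset (Fin k)}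
    (h : Exploring port root recv ω i S) (hr : rL ∈ S) :
    ¬ AtBeginning port root recv ω (i + 1) fun c => c.BackAtRoot root rL := by
  intro hA
  obtain ⟨c, hm, -, hrole⟩ := h.1.of_atBeginning hA
  rw [hm.robot rL hr] at hrole
  simp [lead] at hrole

/-- The last robot, alone at an empty node, begins its way back. -/
theorem arrives_return (hT : (dfs port root T).Stopped k)
    (hl : Inv port root (dfs port root T) (v :: l)) (hrL : Exploring port root recv ω T {rL}) :
    Arrives port root recv ω (T + 2) {rL} v (exploreNode (dfs port root T))
      (lead .ret (some ((dfs port root T).last G v)) .forward) := by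
  rcases hl.place with h1 | ⟨u, l', p, h1, h2, h3, h4⟩ | ⟨l', h1, -⟩
  · simp at h1
  · obtain ⟨rfl, rfl⟩ := List.cons_eq_cons.1 h1
    have h5 := hrL.1
    rw [h2, h3] at h5
    exact explore_alone h5 (by simp) (by simp [exploreNode, hT.2]) (traverse_symm h4)
  · exact absurd (hl.subset _ (by rw [h1]; simp)) hT.2

/-- The root is the last node of the stack, and the only one without a parent port. -/
theorem isLeast_backAtRoot (hT : (dfs port root T).Stopped k)
    (hl : Inv port root (dfs port root T) (v :: l)) (hrL : Exploring port root recv ω T {rL})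
    (hS : ∀ j < T, ∃ S, {rL} ⊆ S ∧ Exploring port root recv ω j S) :
    IsLeast {t | AtBeginning port root recv ω t fun c => c.BackAtRoot root rL}
      (T + 2 + l.length) := by
  have hret := fun {l₁ l₂ : List V} {u : V} => return_rounds (l₁ := l₁) (l₂ := l₂) (u := u) hl
    (Finset.singleton_nonempty rL) (arrives_return hT hl hrL)
  constructor
  · obtain ⟨l₁, a, h1⟩ := List.eq_nil_or_concat' (v :: l) |>.resolve_left (by simp)
    have hlink := hl.linked
    rw [h1] at hlink
    have ha : a = root := hlink.of_append
    obtain ⟨s, hs, hm⟩ := hret h1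
    have hlen := congrArg List.length h1
    simp only [List.length_cons, List.length_append, List.length_nil] at hlen
    have hlen' : l.length = l₁.length := by omega
    rw [hlen']
    refine ⟨s, hm.round, hs, ?_, ?_⟩
    · rw [hm.pos rL (by simp), ha]
    · rw [hm.robot rL (by simp)]
      rfl
  · intro t ht
    by_contra! hlt
    rcases Nat.lt_or_ge t (T + 2) with h1 | h1
    · obtain ⟨i, rfl⟩ := Nat.exists_eq_add_of_le' ht.one_le
      rcases (show i ≤ T by omega).lt_or_eq with hi | rfl
      · obtain ⟨S, hS, hex⟩ := hS i hi
        exact hex.not_backAtRoot (hS (by simp)) ht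
      · exact hrL.not_backAtRoot (by simp) ht
    · obtain ⟨i, rfl⟩ := Nat.exists_eq_add_of_le h1
      have hi : i + 1 < (v :: l).length := by simp only [List.length_cons]; omega
      have hsplit : v :: l = (v :: l).take i ++
          (v :: l)[i] :: (v :: l)[i + 1] :: (v :: l).drop (i + 1 + 1) := by
        rw [List.getElem_cons_drop, List.getElem_cons_drop, List.take_append_drop]
      have harr := hret hsplit
      rw [List.length_take, min_eq_left (by omega)] at harr
      obtain ⟨c, hm, hpos, -⟩ := harr.of_atBeginning ht
      rw [hm.pos rL (by simp)] at hpos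
      have hlink := hl.linked
      rw [hsplit] at hlink
      obtain ⟨⟨p, h2, -⟩, -⟩ := hlink.of_append
      rw [hpos, hl.par_root (hl.subset _ (hl.linked.root_mem))] at h2
      cases h2

/-- From the root the last robot repeats the depth-first search. -/
theorem arrives_repeat (hG : G.Connected) (hk : 2 ≤ k) (hkn : k ≤ Fintype.card V)
    (hT : (dfs port root T).Stopped k) (hmin : ∀ j < T, ¬ (dfs port root j).Stopped k)
    (hl : Inv port root (dfs port root T) (v :: l)) (hrL : Exploring port root recv ω T {rL})
    {i : ℕ} (hi : i ≤ T) :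
    Arrives port root recv ω (T + 2 + l.length + 1 + i) {rL} (dfs port root i).pos
      (repeatNode G (dfs port root i) (dfs port root T) (v :: l))
      (lead .acknowledge (dfs port root i).ent (dfs port root i).dir) := by
  induction i with
  | zero =>
    obtain ⟨l₁, a, h1⟩ := List.eq_nil_or_concat' (v :: l) |>.resolve_left (by simp)
    have hret := return_rounds hl (Finset.singleton_nonempty rL) (arrives_return hT hl hrL) h1
    have hlink := hl.linked
    rw [h1] at hlink
    obtain rfl : a = root := hlink.of_append
    have hroot : a ∈ (dfs port a T).settled := hl.subset _ hl.linked.root_mem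
    have ha : a ∉ l₁ := fun h2 => by
      have hnd := hl.nodup
      rw [h1] at hnd
      exact (List.nodup_append.1 hnd).2.2 a h2 a (by simp) rfl
    have h3 := return_root hret (Finset.singleton_nonempty rL)
      (by simp [returnNode, hroot, hl.par_root hroot, ha])
    have hlen := congrArg List.length h1
    simp only [List.length_cons, List.length_append, List.length_nil] at hlen
    have hlen' : l.length = l₁.length := by omega
    rw [hlen']
    have hnode : repeatNode G (dfs port a 0) (dfs port a T) (v :: l) =
        Function.update (returnNode G (dfs port a T) l₁) a
          (some (host none (some ((dfs port a T).last G a)) false (.ready none))) := by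
      have hcnt : ∀ b, (dfs port a 0).cnt b = 0 := fun _ => rfl
      have hset : (dfs port a 0).settled = ∅ := rfl
      funext b
      rw [h1]
      by_cases hb' : b ∈ (dfs port a T).settled
      · have hc : 0 ≠ (dfs port a T).cnt b := by
          have := hl.cnt_pos b hb'
          omega
        by_cases hb : b = a
        · subst hb
          simp [repeatNode, hb', hl.par_root hb', hcnt, hset, hc]
        · simp [repeatNode, returnNode, hb', hb, hcnt, hset, hc]
      · have hb : b ≠ a := fun h4 => hb' (h4 ▸ hroot)
        simp [repeatNode, returnNode, hb', hb]
    rw [hnode]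
    exact h3
  | succ i ih =>
    obtain ⟨⟨l', hl'⟩, -⟩ := exists_inv_dfs (i := i) hG hk hkn fun j _ => hmin j (by omega)
    have hbef := dfs_before hG hk hkn hmin hi le_rfl
    rw [dfs_succ] at hbef ⊢
    exact repeat_round hG (by omega) hl' hl hbef (Finset.singleton_nonempty rL) (ih (by omega))

/-- The last robot meets only robots that have terminated: it turns round at the empty node, becomes
done at the node from which it came, and terminates back at the empty node. -/
theorem fromEndOf_last_round (hG : G.Connected) (hk : 2 ≤ k) (hkn : k ≤ Fintype.card V)
    (hT : (dfs port root T).Stopped k) (hmin : ∀ j < T, ¬ (dfs port root j).Stopped k)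
    (hl : Inv port root (dfs port root T) (v :: l)) (hrL : Exploring port root recv ω T {rL}) :
    FromEndOf port root recv ω (T + 2 + l.length + (T + 1) + 2) fun c =>
      c.Dispersed ∧ c.AllTerminated := by
  have hS := Finset.singleton_nonempty rL
  have h := arrives_repeat hG hk hkn hT hmin hl hrL le_rfl
  have hnode : repeatNode G (dfs port root T) (dfs port root T) (v :: l)
      (dfs port root T).pos = none := by simp [repeatNode, hT.2]
  rcases hl.place with h1 | ⟨u, l', p, h1, h2, h3, h4⟩ | ⟨l', h1, -⟩
  · simp at h1
  · have hu : u ∈ (dfs port root T).settled := hl.subset u (by rw [h1]; simp)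
    rw [h2, h3] at h
    have h5 := acknowledge_forward h hS (.inl (by rw [hnode]; rfl)) (traverse_symm h4)
    have h6 := done_terminates (acknowledge_done h5 hS (by simp [repeatNode, hu, replyOf, host])
      h4) hS
    have h7 : T + 2 + l.length + 1 + T + 1 + 1 + 1 = T + 2 + l.length + (T + 1) + 2 + 1 := by
      omega
    rw [h7] at h6
    refine h6.fromEndOf rfl hnode fun w m hm => ?_
    simp only [repeatNode, if_true] at hm
    split_ifs at hm
    all_goals
      rw [← Option.some.inj hm]
      rfl
  · exact absurd (hl.subset _ (by rw [h1]; simp)) hT.2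

end Stages

end Dispersion

open Dispersion in
theorem mainTheorem1 {V : Type*} [Fintype V] [DecidableEq V] (G : SimpleGraph V)
    [DecidableRel G.Adj] (hG : G.Connected) (port : Dispersion.PortLabelling G) (root : V)
    (k : ℕ) (hk : 2 ≤ k) (hkn : k ≤ Fintype.card V) :
    ∃ t₁ t₂ : ℕ, ∀ᵐ ω ∂(Dispersion.coinMeasure k), ∀ recv : Dispersion.Reception k,
      ∃ rL : Fin k,
        IsLeast {t | Dispersion.AtBeginning port root recv ω t fun c => c.FirstStageOver rL} t₁ ∧
        IsLeast {t | Dispersion.AtBeginning port root recv ω t fun c => c.BackAtRoot root rL} t₂ ∧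
        Dispersion.FromEndOf port root recv ω (t₂ + t₁ + 2) fun c =>
          c.Dispersed ∧ c.AllTerminated := by
  have hex := exists_stopped hG hk hkn port root
  classical
  obtain ⟨T, hT, hmin⟩ : ∃ T, (dfs port root T).Stopped k ∧
      ∀ j < T, ¬ (dfs port root j).Stopped k :=
    ⟨Nat.find hex, Nat.find_spec hex, fun j hj => Nat.find_min hex hj⟩
  obtain ⟨⟨l, hl⟩, -⟩ := exists_inv_dfs (i := T) hG hk hkn hmin
  obtain ⟨v, l, rfl⟩ : ∃ v l', l = v :: l' := by
    refine List.exists_cons_of_ne_nil fun hnil => ?_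
    rcases hl.place with h1 | ⟨_, _, _, h1, -⟩ | ⟨_, h1, -⟩
    · have := hT.1
      rw [h1.2.1, Finset.card_empty] at this
      omega
    · simp [hnil] at h1
    · simp [hnil] at h1
  refine ⟨T + 1, T + 2 + l.length, (ae_decisive k).mono fun ω hω recv => ?_⟩
  obtain ⟨S, hex, hS⟩ := exists_exploring (port := port) (root := root) (recv := recv) hω hG hk hkn
    hmin le_rfl
  obtain ⟨rL, rfl⟩ : ∃ rL, S = {rL} := by
    rw [← Finset.card_eq_one]
    have := hex.2
    have := hT.1
    omega
  exact ⟨rL, isLeast_firstStageOver hT hmin hex hS, isLeast_backAtRoot hT hl hex hS,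
    fromEndOf_last_round hG hk hkn hT hmin hl hex⟩
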